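/- (Chevalley's theorem.) Let $X$ be an affine scheme, let $Y$ be a noetherian scheme, and let $f : X \to Y$ be a finite surjective morphism of schemes. Then $Y$ is affine. -/

import Mathlib

universe u

open CategoryTheory AlgebraicGeometry

namespace AlgebraicGeometry.Chevalley

open Limits TopologicalSpace

/-! The proof is a noetherian induction on closed subschemes of `Y` (`isAffine_subscheme`), using
global sections instead of cohomology. One may assume that every proper closed subscheme is affine
(`isAffine_of_forall_closed`). If `Y` is not reduced, it is a square-zero thickening of a proper
closed subscheme (`isAffine_of_sq_zero`). If it is reduced and reducible, it is the union of two
proper closed subschemes (`isAffine_of_closed_cover`).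

There remains the case of `Y` integral (`isAffine_of_isIntegral`), where `X` may be taken integral
too. A nonzero ideal sheaf `D` clears the denominators of the matrices by which sections of `X` act
on the function field of `X` over that of `Y`. Let `Z` be the proper, hence affine, subscheme cut
out by `D * D`. If a section `b` of `X` agrees on the fibre product with a section of `Z`, its
matrix is regular on `Y` and locally scalar modulo `D`. So its characteristic polynomial has
coefficients in `Γ(Y, ⊤)`, and its norm vanishes exactly below the zeros of `b`.

Such norms provide enough affine loci to make `Y` quasi-affine. The same polynomials make `Γ(X, ⊤)`
integral over `Γ(Y, ⊤)`, so by lying over every prime of `Γ(Y, ⊤)` comes from a point of `X`, and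
the open immersion of `Y` into its affine hull is onto. -/

/-! ### Quasi-affineness and sections supported in an open set -/

theorem mem_basicOpen_iff_notMem_toSpecΓ {X : Scheme.{u}} (b : Γ(X, ⊤)) (x : X) :
    x ∈ X.basicOpen b ↔ b ∉ (X.toSpecΓ x).asIdeal := by
  rw [← Scheme.toSpecΓ_preimage_basicOpen]
  rfl

theorem exists_toSpecΓ_eq {X : Scheme.{u}} [IsAffine X] (p : PrimeSpectrum Γ(X, ⊤)) :
    ∃ x : X, X.toSpecΓ x = p :=
  (Scheme.Hom.surjective X.isoSpec.hom) p

/-- A quasi-affine scheme is affine as soon as the spectrum of its ring of global sections is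
covered by the images of two affine schemes lying over it. -/
theorem isAffine_of_isQuasiAffine_of_range_union {X Y Z : Scheme.{u}} (f : X ⟶ Y) (i : Z ⟶ Y)
    [IsAffine X] [IsAffine Z] [Y.IsQuasiAffine]
    (h : ∀ p : PrimeSpectrum Γ(Y, ⊤), p ∈ Set.range (PrimeSpectrum.comap f.appTop.hom) ∨
      p ∈ Set.range (PrimeSpectrum.comap i.appTop.hom)) : IsAffine Y := by
  -- A prime pulled back from an affine `W` is the image of a point of `W`, which passes through `Y`
  -- by naturality.
  have aux : ∀ {W : Scheme.{u}} (g : W ⟶ Y) [IsAffine W],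
      Set.range (PrimeSpectrum.comap g.appTop.hom) ⊆ Set.range Y.toSpecΓ := by
    rintro W g _ _ ⟨q, rfl⟩
    obtain ⟨x, rfl⟩ := exists_toSpecΓ_eq q
    refine ⟨g x, ?_⟩
    have := congr($(Scheme.toSpecΓ_naturality g) x)
    simp only [Scheme.Hom.comp_apply] at this
    exact this
  have : Surjective Y.toSpecΓ := ⟨fun p ↦ (h p).elim (fun h ↦ aux f h) (fun h ↦ aux i h)⟩
  have : IsIso Y.toSpecΓ := (isIso_iff_isOpenImmersion_and_epi_base _).mpr
    ⟨inferInstance, (TopCat.epi_iff_surjective _).mpr Y.toSpecΓ.surjective⟩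
  exact ⟨this⟩

/-- The ideal of sections on an affine scheme that vanish outside of an open set. -/
def vanishingOutside {X : Scheme.{u}} (U : X.Opens) : Ideal Γ(X, ⊤) where
  carrier := {b | X.basicOpen b ≤ U}
  zero_mem' := by simp
  add_mem' {a b} ha hb := by
    intro x hx
    rw [mem_basicOpen_iff_notMem_toSpecΓ] at hx
    by_cases h : x ∈ X.basicOpen a
    · exact ha h
    · refine hb ?_
      rw [mem_basicOpen_iff_notMem_toSpecΓ] at h ⊢
      exact fun hb ↦ hx (add_mem (not_not.mp h) hb)
  smul_mem' c a ha := by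
    rw [Set.mem_ofPred_eq, smul_eq_mul, Scheme.basicOpen_mul]
    exact inf_le_right.trans ha

theorem mem_vanishingOutside {X : Scheme.{u}} {U : X.Opens} {b : Γ(X, ⊤)} :
    b ∈ vanishingOutside U ↔ X.basicOpen b ≤ U := Iff.rfl

theorem exists_mem_vanishingOutside {X : Scheme.{u}} [IsAffine X] {U : X.Opens} {x : X}
    (hx : x ∈ U) : ∃ b ∈ vanishingOutside U, x ∈ X.basicOpen b := by
  obtain ⟨_, ⟨_, ⟨b, rfl⟩, rfl⟩, hb, hbU⟩ :=
    (isBasis_basicOpen X).exists_subset_of_mem_open hx U.isOpen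
  exact ⟨b, hbU, hb⟩

/-- The hypothesis puts `b` in the radical of `K ⊔ vanishingOutside U`. The exponent is kept
positive so that the power has the same nonvanishing locus as `b`. -/
theorem exists_pow_sub_mem_vanishingOutside {X : Scheme.{u}} [IsAffine X] (U : X.Opens)
    (K : Ideal Γ(X, ⊤)) (b : Γ(X, ⊤))
    (h : ∀ x ∈ X.basicOpen b, (∀ k ∈ K, x ∉ X.basicOpen k) → x ∈ U) :
    ∃ n : ℕ, ∃ k ∈ K, b ^ (n + 1) - k ∈ vanishingOutside U := by
  have hb : b ∈ (K ⊔ vanishingOutside U).radical := by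
    rw [Ideal.radical_eq_sInf, Submodule.mem_sInf]
    rintro p ⟨hp, hp'⟩
    obtain ⟨x, hx⟩ := exists_toSpecΓ_eq (X := X) ⟨p, hp'⟩
    by_contra hbp
    have hmem : ∀ c : Γ(X, ⊤), x ∈ X.basicOpen c ↔ c ∉ p := fun c ↦ by
      rw [mem_basicOpen_iff_notMem_toSpecΓ, hx]
    have hxU : x ∈ U := h x ((hmem b).mpr hbp)
      fun k hk ↦ by simpa [hmem] using hp (Ideal.mem_sup_left hk)
    obtain ⟨c, hc, hxc⟩ := exists_mem_vanishingOutside hxU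
    exact (hmem c).mp hxc (hp (Ideal.mem_sup_right hc))
  obtain ⟨n, hn⟩ := hb
  have hn' : b ^ (n + 1) ∈ K ⊔ vanishingOutside U := pow_succ b n ▸ Ideal.mul_mem_right _ _ hn
  obtain ⟨k, hk, j, hj, e⟩ := Submodule.mem_sup.mp hn'
  exact ⟨n, k, hk, by rwa [← e, add_sub_cancel_left]⟩

theorem exists_mem_forall_notMem_asIdeal {R : Type*} [CommRing R] (I : Ideal R)
    {F : Set (PrimeSpectrum R)} (hF : F.Finite) (h : ∀ p ∈ F, ¬ I ≤ p.asIdeal) :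
    ∃ k ∈ I, ∀ p ∈ F, k ∉ p.asIdeal := by
  by_contra! H
  obtain rfl | ⟨p₀, -⟩ := F.eq_empty_or_nonempty
  · obtain ⟨p, hp, -⟩ := H 0 (zero_mem _)
    exact hp
  have hsub : (I : Set R) ⊆ ⋃ p ∈ (hF.toFinset : Set (PrimeSpectrum R)), (p.asIdeal : Set R) := by
    intro k hk
    obtain ⟨p, hp, hkp⟩ := H k hk
    exact Set.mem_biUnion (by simpa using hp) hkp
  -- Prime avoidance allows two exceptional non-prime indices; none is needed here, so any element
  -- fills both slots.
  rw [Ideal.subset_union_prime p₀ p₀ fun p _ _ _ ↦ p.isPrime] at hsub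
  obtain ⟨p, hp, hle⟩ := hsub
  exact h p (by simpa using hp) hle

theorem exists_mem_vanishingOutside_of_finite {X : Scheme.{u}} [IsAffine X] (U : X.Opens)
    (K : Ideal Γ(X, ⊤)) {F : Set X} (hF : F.Finite) (hFU : ∀ x ∈ F, x ∈ U)
    (hK : ∀ x ∈ F, ∃ k ∈ K, x ∈ X.basicOpen k) :
    ∃ k ∈ K, k ∈ vanishingOutside U ∧ ∀ x ∈ F, x ∈ X.basicOpen k := by
  obtain ⟨k, hk, hk'⟩ := exists_mem_forall_notMem_asIdeal (K ⊓ vanishingOutside U)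
    (hF.image fun x ↦ (X.toSpecΓ x : PrimeSpectrum Γ(X, ⊤))) (by
      rintro p ⟨x, hx, hp⟩ hle
      subst hp
      obtain ⟨k, hk, hxk⟩ := hK x hx
      obtain ⟨j, hj, hxj⟩ := exists_mem_vanishingOutside (hFU x hx)
      rw [mem_basicOpen_iff_notMem_toSpecΓ] at hxk hxj
      exact ((X.toSpecΓ x).isPrime.mem_or_mem (hle ⟨K.mul_mem_right j hk,
        (vanishingOutside U).mul_mem_left k hj⟩)).elim hxk hxj)
  refine ⟨k, hk.1, hk.2, fun x hx ↦ ?_⟩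
  rw [mem_basicOpen_iff_notMem_toSpecΓ]
  exact hk' _ (Set.mem_image_of_mem _ hx)

theorem exists_mem_ker_appTop_of_notMem_range {P X : Scheme.{u}} [IsAffine X] (j : P ⟶ X)
    [IsClosedImmersion j] {x : X} (hx : x ∉ Set.range j) :
    ∃ k ∈ RingHom.ker j.appTop.hom, x ∈ X.basicOpen k := by
  have hx' : x ∉ j.ker.support := by
    rwa [← SetLike.mem_coe, Scheme.Hom.support_ker, j.isClosedEmbedding.isClosed_range.closure_eq]
  rw [Scheme.IdealSheafData.mem_support_iff_of_mem (U := ⟨⊤, isAffineOpen_top X⟩) trivial,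
    Scheme.Hom.ker_apply, Scheme.mem_zeroLocus_iff] at hx'
  push Not at hx'
  exact hx'

theorem appTop_surjective_of_isClosedImmersion {P X : Scheme.{u}} [IsAffine X] (j : P ⟶ X)
    [IsClosedImmersion j] : Function.Surjective j.appTop :=
  j.app_surjective ⊤ (isAffineOpen_top X)

theorem isAffineOpen_basicOpen_of_le {Y : Scheme.{u}} {V : Y.Opens} (hV : IsAffineOpen V)
    (a : Γ(Y, ⊤)) (h : Y.basicOpen a ≤ V) : IsAffineOpen (Y.basicOpen a) := by
  have := hV.basicOpen (Y.presheaf.map (homOfLE le_top).op a)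
  rwa [Scheme.basicOpen_res, inf_eq_right.mpr h] at this

/-- A scheme covered by a finite morphism from an affine scheme and an affine closed subscheme is
quasi-affine, provided that nonvanishing loci of compatible pairs of sections descend. -/
theorem isQuasiAffine_of_forall_exists {X Y Z : Scheme.{u}} (f : X ⟶ Y) (i : Z ⟶ Y)
    [IsFinite f] [IsClosedImmersion i] [IsAffine X] [IsAffine Z] [CompactSpace Y]
    (hcov : ∀ y : Y, y ∈ Set.range f ∨ y ∈ Set.range i)
    (H : ∀ (b : Γ(X, ⊤)) (c : Γ(Z, ⊤)),
      (pullback.fst f i).appTop b = (pullback.snd f i).appTop c →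
      ∃ a : Γ(Y, ⊤), ∀ y : Y, y ∈ Y.basicOpen a ↔
        (∀ x : X, f x = y → x ∈ X.basicOpen b) ∧ (∀ z : Z, i z = y → z ∈ Z.basicOpen c)) :
    Y.IsQuasiAffine := by
  refine Scheme.IsQuasiAffine.of_forall_exists_mem_basicOpen _ fun y ↦ ?_
  obtain ⟨V, hV, hyV, -⟩ := exists_isAffineOpen_mem_and_subset (X := Y) (x := y) (U := ⊤) trivial
  -- The section descended from such a pair is nonzero at `y` and its locus lies in the affine `V`,
  -- hence is affine.
  suffices ∃ (b : Γ(X, ⊤)) (c : Γ(Z, ⊤)),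
      (pullback.fst f i).appTop b = (pullback.snd f i).appTop c ∧
      X.basicOpen b ≤ f ⁻¹ᵁ V ∧ Z.basicOpen c ≤ i ⁻¹ᵁ V ∧
      (∀ x : X, f x = y → x ∈ X.basicOpen b) ∧ (∀ z : Z, i z = y → z ∈ Z.basicOpen c) by
    obtain ⟨b, c, e, hb, hc, hbc⟩ := this
    obtain ⟨a, ha⟩ := H b c e
    refine ⟨a, isAffineOpen_basicOpen_of_le hV a fun y' hy' ↦ ?_, (ha y).mpr hbc⟩
    obtain ⟨x, rfl⟩ | ⟨z, rfl⟩ := hcov y'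
    · exact hb (((ha _).mp hy').1 x rfl)
    · exact hc (((ha _).mp hy').2 z rfl)
  have hfib : ∀ (x : X) (z : Z), f x = i z → ∃ p : (pullback f i : Scheme.{u}),
      pullback.fst f i p = x ∧ pullback.snd f i p = z := fun x z h ↦
    Scheme.Pullback.exists_preimage_pullback x z h
  by_cases hy : y ∈ Set.range i
  · obtain ⟨z, rfl⟩ := hy
    obtain ⟨c, hcV, hzc⟩ := exists_mem_vanishingOutside (U := i ⁻¹ᵁ V) (x := z) hyV
    obtain ⟨b, hb⟩ := appTop_surjective_of_isClosedImmersion (pullback.fst f i)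
      ((pullback.snd f i).appTop c)
    have hbc : ∀ p : (pullback f i : Scheme.{u}), pullback.fst f i p ∈ X.basicOpen b ↔
        pullback.snd f i p ∈ Z.basicOpen c := fun p ↦ by
      have := congr((pullback f i).basicOpen $hb)
      rw [← Scheme.preimage_basicOpen_top, ← Scheme.preimage_basicOpen_top] at this
      exact congr(p ∈ $this).to_iff
    -- The lift `b` is controlled only on the fibre product. A power of it, corrected by a section
    -- vanishing there, is supported over `V` and still matches the same power of `c`.
    obtain ⟨n, k, hk, hj⟩ := exists_pow_sub_mem_vanishingOutside (f ⁻¹ᵁ V)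
      (RingHom.ker (pullback.fst f i).appTop.hom) b (by
        intro x hxb hx
        by_cases hr : x ∈ Set.range (pullback.fst f i)
        · obtain ⟨p, rfl⟩ := hr
          have := hcV ((hbc p).mp hxb)
          have e := congr($(pullback.condition (f := f) (g := i)) p)
          simp only [Scheme.Hom.comp_apply] at e
          change f _ ∈ V
          rw [e]
          exact this
        · obtain ⟨k, hk, hxk⟩ := exists_mem_ker_appTop_of_notMem_range _ hr
          exact absurd hxk (hx k hk))
    have hkp : (pullback.fst f i).appTop k = 0 := hk
    have e : (pullback.fst f i).appTop (b ^ (n + 1) - k) =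
        (pullback.snd f i).appTop (c ^ (n + 1)) := by
      rw [map_sub, map_pow, map_pow, hb, hkp, sub_zero]
    refine ⟨b ^ (n + 1) - k, c ^ (n + 1), e, hj, ?_, fun x hx ↦ ?_, fun z' hz' ↦ ?_⟩
    · rw [Scheme.basicOpen_pow _ _ n.succ_pos]
      exact hcV
    · obtain ⟨p, rfl, rfl⟩ := hfib x z hx
      have := congr((pullback f i).basicOpen $e)
      rw [← Scheme.preimage_basicOpen_top, ← Scheme.preimage_basicOpen_top] at this
      refine congr(p ∈ $this).to_iff.mpr ?_
      rw [Scheme.basicOpen_pow _ _ n.succ_pos]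
      exact hzc
    · rw [Scheme.basicOpen_pow _ _ n.succ_pos]
      rwa [i.isClosedEmbedding.injective hz']
  -- Off `Z` take `c = 0`; the fibre over `y` is finite, so prime avoidance gives one `k` nonzero at
  -- all its points.
  · obtain ⟨k, hk, hkV, hky⟩ := exists_mem_vanishingOutside_of_finite (f ⁻¹ᵁ V)
      (RingHom.ker (pullback.fst f i).appTop.hom) (f.finite_preimage_singleton y)
      (by rintro x rfl; exact hyV) (fun x hx ↦ by
        refine exists_mem_ker_appTop_of_notMem_range _ ?_
        rintro ⟨p, rfl⟩
        refine hy ⟨pullback.snd f i p, ?_⟩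
        have e := congr($(pullback.condition (f := f) (g := i)) p)
        simp only [Scheme.Hom.comp_apply] at e
        rw [← e]
        exact hx)
    have hkp : (pullback.fst f i).appTop k = 0 := hk
    refine ⟨k, 0, by rw [hkp, map_zero], hkV, by simp, fun x hx ↦ hky x hx,
      fun z hz ↦ (hy ⟨z, hz⟩).elim⟩

/-! ### Restriction, pullback and gluing of sections -/

/-- Restriction of sections to a smaller open set. -/
noncomputable def res {Y : Scheme.{u}} {U V : Y.Opens} (h : U ≤ V) : Γ(Y, V) →+* Γ(Y, U) :=
  (Y.presheaf.map (homOfLE h).op).hom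

/-- The action of a morphism on sections. -/
noncomputable def pull {X Y : Scheme.{u}} (f : X ⟶ Y) (U : Y.Opens) :
    Γ(Y, U) →+* Γ(X, f ⁻¹ᵁ U) :=
  (f.app U).hom

theorem res_res {Y : Scheme.{u}} {U V W : Y.Opens} (h : U ≤ V) (h' : V ≤ W) (s : Γ(Y, W)) :
    res h (res h' s) = res (h.trans h') s := by
  simp only [res, ← CommRingCat.comp_apply, ← Functor.map_comp]
  rfl

@[simp]
theorem res_self {Y : Scheme.{u}} {U : Y.Opens} (s : Γ(Y, U)) : res le_rfl s = s := by
  change Y.presheaf.map (𝟙 _) s = s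
  simp

theorem pull_res {X Y : Scheme.{u}} (f : X ⟶ Y) {U V : Y.Opens} (h : U ≤ V)
    (h' : f ⁻¹ᵁ U ≤ f ⁻¹ᵁ V) (s : Γ(Y, V)) :
    pull f U (res h s) = res h' (pull f V s) :=
  congr($(f.naturality (homOfLE h).op) s)

theorem basicOpen_res {Y : Scheme.{u}} {U V : Y.Opens} (h : U ≤ V) (s : Γ(Y, V)) :
    Y.basicOpen (res h s) = U ⊓ Y.basicOpen s :=
  Scheme.basicOpen_res _ _ _

theorem basicOpen_pull {X Y : Scheme.{u}} (f : X ⟶ Y) (U : Y.Opens) (s : Γ(Y, U)) :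
    X.basicOpen (pull f U s) = f ⁻¹ᵁ Y.basicOpen s :=
  (Scheme.preimage_basicOpen f s).symm

theorem pull_surjective {X Y : Scheme.{u}} (i : X ⟶ Y) [IsClosedImmersion i] {U : Y.Opens}
    (hU : IsAffineOpen U) : Function.Surjective (pull i U) :=
  i.app_surjective U hU

theorem exists_res_eq_of_sup_eq {Y : Scheme.{u}} {W U₁ U₂ : Y.Opens} (hW : U₁ ⊔ U₂ = W)
    (h₁ : U₁ ≤ W) (h₂ : U₂ ≤ W) (s₁ : Γ(Y, U₁)) (s₂ : Γ(Y, U₂))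
    (h : res (inf_le_left : U₁ ⊓ U₂ ≤ U₁) s₁ = res inf_le_right s₂) :
    ∃ s : Γ(Y, W), res h₁ s = s₁ ∧ res h₂ s = s₂ := by
  subst hW
  exact ⟨(Y.sheaf.objSupIsoProdEqLocus U₁ U₂).inv ⟨(s₁, s₂), h⟩,
    Y.sheaf.objSupIsoProdEqLocus_inv_fst U₁ U₂ _, Y.sheaf.objSupIsoProdEqLocus_inv_snd U₁ U₂ _⟩

theorem eq_of_res_eq_of_sup_eq {Y : Scheme.{u}} {W U₁ U₂ : Y.Opens} (hW : U₁ ⊔ U₂ = W)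
    (h₁ : U₁ ≤ W) (h₂ : U₂ ≤ W) (s t : Γ(Y, W)) (e₁ : res h₁ s = res h₁ t)
    (e₂ : res h₂ s = res h₂ t) : s = t :=
  Y.sheaf.eq_of_locally_eq₂ (homOfLE h₁) (homOfLE h₂) hW.ge s t e₁ e₂

/-! ### Square-zero thickenings -/

theorem mem_nilradical_of_mem_ker {X Y : Scheme.{u}} (f : X ⟶ Y) [Surjective f] [CompactSpace Y]
    {a : Γ(Y, ⊤)} (ha : f.appTop a = 0) : a ∈ nilradical Γ(Y, ⊤) := by
  rw [mem_nilradical, Scheme.isNilpotent_iff_basicOpen_eq_bot, eq_bot_iff]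
  intro y hy
  obtain ⟨x, rfl⟩ := f.surjective y
  have hx : x ∈ f ⁻¹ᵁ Y.basicOpen a := hy
  rw [Scheme.preimage_basicOpen_top, ha] at hx
  simp at hx

/-- If a surjective morphism has an affine source and is surjective on global sections, then its
target is affine. -/
theorem isAffine_of_appTop_surjective {Z Y : Scheme.{u}} (i : Z ⟶ Y) [IsAffine Z]
    [Surjective i] (h : Function.Surjective i.appTop) : IsAffine Y := by
  have : CompactSpace Y := i.surjective.compactSpace i.continuous
  have : Y.IsQuasiAffine := by
    refine Scheme.IsQuasiAffine.of_forall_exists_mem_basicOpen _ fun y ↦ ?_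
    obtain ⟨z, rfl⟩ := i.surjective y
    obtain ⟨V, hV, hyV, -⟩ :=
      exists_isAffineOpen_mem_and_subset (X := Y) (x := i z) (U := ⊤) trivial
    obtain ⟨c, hcV, hzc⟩ := exists_mem_vanishingOutside (U := i ⁻¹ᵁ V) (x := z) hyV
    obtain ⟨a, rfl⟩ := h c
    rw [mem_vanishingOutside, ← Scheme.preimage_basicOpen_top] at hcV
    rw [← Scheme.preimage_basicOpen_top] at hzc
    refine ⟨a, isAffineOpen_basicOpen_of_le hV a fun y hy ↦ ?_, hzc⟩
    obtain ⟨z', rfl⟩ := i.surjective y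
    exact hcV hy
  refine isAffine_of_isQuasiAffine_of_range_union i i fun p ↦ .inl ?_
  rw [range_comap_of_surjective _ _ h]
  exact fun a ha ↦ nilradical_le_prime p.asIdeal (mem_nilradical_of_mem_ker i ha)

theorem eq_of_preimage_eq {Z Y : Scheme.{u}} (i : Z ⟶ Y) [Surjective i] {U V : Y.Opens}
    (h : i ⁻¹ᵁ U = i ⁻¹ᵁ V) : U = V := by
  ext y
  obtain ⟨z, rfl⟩ := i.surjective y
  exact congr(z ∈ $h).to_iff

/-- If `D` is the locus where `g` does not vanish, then a section over `D` killed by a closed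
immersion extends over all of an affine open, to a section killed by the same immersion, after
multiplication with a power of `g`. -/
theorem exists_res_eq_pow_mul {Z Y : Scheme.{u}} (i : Z ⟶ Y) [IsClosedImmersion i]
    {U D : Y.Opens} (hU : IsAffineOpen U) (g : Γ(Y, U)) (hD : Y.basicOpen g = D) (h : D ≤ U)
    (d : Γ(Y, D)) (hd : pull i D d = 0) :
    ∃ (n : ℕ) (e : Γ(Y, U)), pull i U e = 0 ∧ res h e = res h g ^ n * d := by
  subst hD
  obtain ⟨n, e, he⟩ := exists_eq_pow_mul_of_isAffineOpen Y U hU g d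
  replace he : res h e = res h g ^ n * d := he
  have hZ : IsAffineOpen (i ⁻¹ᵁ U) := hU.preimage i
  have h0 : res (Scheme.basicOpen_le _ _ : Z.basicOpen (pull i U g) ≤ i ⁻¹ᵁ U) (pull i U e) = 0 := by
    have h1 := pull_res i h (i.preimage_mono h) e
    rw [he, map_mul, hd, mul_zero] at h1
    have h2 := congr(res (basicOpen_pull i U g).le $h1)
    rw [map_zero, res_res] at h2
    exact h2.symm
  -- The first extension dies on `Z` only where `g` is invertible; a further power of `g` kills it
  -- everywhere.
  obtain ⟨m, hm⟩ := exists_pow_mul_eq_zero_of_res_basicOpen_eq_zero_of_isAffineOpen Z hZ _ _ h0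
  refine ⟨m + n, g ^ m * e, by rw [map_mul, map_pow, hm], ?_⟩
  rw [map_mul, map_pow, he, pow_add, mul_assoc]

/-- The obstruction is a Čech 1-cocycle `d` with values in the kernel, which is a module over the
sections of `Z` because it squares to zero. A relation `r₁ * g₁ ^ m + r₂ * g₂ ^ n = 1` splits `d`
into two parts, each extending to one of the two opens. -/
theorem pull_surjective_of_sup_eq {Z Y : Scheme.{u}} (i : Z ⟶ Y) [IsClosedImmersion i]
    [Surjective i]
    (hsq : ∀ (U : Y.Opens) (s t : Γ(Y, U)), pull i U s = 0 → pull i U t = 0 → s * t = 0)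
    {W U₁ U₂ : Y.Opens} (hU₁ : IsAffineOpen U₁) (hU₂ : IsAffineOpen U₂)
    (hW : U₁ ⊔ U₂ = W) (g₁ g₂ : Γ(Z, i ⁻¹ᵁ W)) (hg : IsCoprime g₁ g₂)
    (h₁ : i ⁻¹ᵁ U₁ = Z.basicOpen g₁) (h₂ : i ⁻¹ᵁ U₂ = Z.basicOpen g₂) :
    Function.Surjective (pull i W) := by
  intro h
  have l₁ : U₁ ≤ W := hW ▸ le_sup_left
  have l₂ : U₂ ≤ W := hW ▸ le_sup_right
  have hlift₁ : ∀ s : Γ(Z, i ⁻¹ᵁ W), ∃ t : Γ(Y, U₁), pull i U₁ t = res (i.preimage_mono l₁) s :=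
    fun s ↦ pull_surjective i hU₁ _
  have hlift₂ : ∀ s : Γ(Z, i ⁻¹ᵁ W), ∃ t : Γ(Y, U₂), pull i U₂ t = res (i.preimage_mono l₂) s :=
    fun s ↦ pull_surjective i hU₂ _
  obtain ⟨γ₂, hγ₂⟩ := hlift₁ g₂
  obtain ⟨γ₁, hγ₁⟩ := hlift₂ g₁
  have b₂ : Y.basicOpen γ₂ = U₁ ⊓ U₂ := eq_of_preimage_eq i (by
    rw [← basicOpen_pull, hγ₂, basicOpen_res, ← h₂]; rfl)
  have b₁ : Y.basicOpen γ₁ = U₁ ⊓ U₂ := eq_of_preimage_eq i (by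
    rw [← basicOpen_pull, hγ₁, basicOpen_res, ← h₁, inf_comm]; rfl)
  obtain ⟨p₁, hp₁⟩ := hlift₁ h
  obtain ⟨p₂, hp₂⟩ := hlift₂ h
  have k₁ : U₁ ⊓ U₂ ≤ U₁ := inf_le_left
  have k₂ : U₁ ⊓ U₂ ≤ U₂ := inf_le_right
  have key₁ : ∀ (s : Γ(Z, i ⁻¹ᵁ W)) (t : Γ(Y, U₁)), pull i U₁ t = res (i.preimage_mono l₁) s →
      pull i (U₁ ⊓ U₂) (res k₁ t) = res (i.preimage_mono (k₁.trans l₁)) s := fun s t ht ↦ by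
    rw [pull_res i k₁ (i.preimage_mono k₁), ht, res_res]
  have key₂ : ∀ (s : Γ(Z, i ⁻¹ᵁ W)) (t : Γ(Y, U₂)), pull i U₂ t = res (i.preimage_mono l₂) s →
      pull i (U₁ ⊓ U₂) (res k₂ t) = res (i.preimage_mono (k₁.trans l₁)) s := fun s t ht ↦ by
    rw [pull_res i k₂ (i.preimage_mono k₂), ht, res_res]
  set d := res k₁ p₁ - res k₂ p₂ with hd
  have hd0 : pull i (U₁ ⊓ U₂) d = 0 := by
    rw [hd, map_sub, key₁ h p₁ hp₁, key₂ h p₂ hp₂, sub_self]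
  obtain ⟨n, e₁, he₁, hn⟩ := exists_res_eq_pow_mul i hU₁ γ₂ b₂ k₁ d hd0
  obtain ⟨m, e₂, he₂, hm⟩ := exists_res_eq_pow_mul i hU₂ γ₁ b₁ k₂ d hd0
  obtain ⟨r₁, r₂, hr⟩ := hg.pow (m := m) (n := n)
  obtain ⟨ρ₁, hρ₁⟩ := hlift₂ r₁
  obtain ⟨ρ₂, hρ₂⟩ := hlift₁ r₂
  -- The lifted relation holds only modulo the kernel, but the error annihilates `d`.
  have hone : pull i (U₁ ⊓ U₂)
      (res k₂ ρ₁ * res k₂ γ₁ ^ m + res k₁ ρ₂ * res k₁ γ₂ ^ n - 1) = 0 := by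
    rw [map_sub, map_add, map_mul, map_mul, map_pow, map_pow, key₂ _ _ hρ₁, key₂ _ _ hγ₁,
      key₁ _ _ hρ₂, key₁ _ _ hγ₂, ← map_pow, ← map_pow, ← map_mul, ← map_mul, ← map_add, hr,
      map_one, map_one, sub_self]
  have hmul := hsq _ _ _ hone hd0
  obtain ⟨a, ha₁, ha₂⟩ := exists_res_eq_of_sup_eq hW l₁ l₂ (p₁ - ρ₂ * e₁) (p₂ + ρ₁ * e₂) (by
    rw [map_sub, map_add, map_mul, map_mul, hn, hm]
    linear_combination -hmul - hd)
  refine ⟨a, eq_of_res_eq_of_sup_eq (U₁ := i ⁻¹ᵁ U₁) (U₂ := i ⁻¹ᵁ U₂) (by rw [← hW]; rfl)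
    (i.preimage_mono l₁) (i.preimage_mono l₂) _ _ ?_ ?_⟩
  · rw [← pull_res i l₁, ha₁, map_sub, map_mul, he₁, mul_zero, sub_zero, hp₁]
  · rw [← pull_res i l₂, ha₂, map_add, map_mul, he₂, mul_zero, add_zero, hp₂]

theorem isAffineOpen_of_pull_surjective {Z Y : Scheme.{u}} (i : Z ⟶ Y) [Surjective i]
    {W : Y.Opens} (hZ : IsAffineOpen (i ⁻¹ᵁ W)) (h : Function.Surjective (pull i W)) :
    IsAffineOpen W := by
  have : IsAffine (i ⁻¹ᵁ W).toScheme := hZ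
  have : Surjective (i ∣_ W) := IsZariskiLocalAtTarget.restrict ‹Surjective i› W
  refine isAffine_of_appTop_surjective (i ∣_ W) ?_
  intro s
  have e : W.ι ''ᵁ ⊤ = W := W.ι_image_top
  have e' : (i ⁻¹ᵁ W).ι ''ᵁ ⊤ = i ⁻¹ᵁ W := (i ⁻¹ᵁ W).ι_image_top
  obtain ⟨t, ht⟩ := h (res e'.ge s)
  refine ⟨res e.le t, ?_⟩
  rw [morphismRestrict_appTop]
  change res _ (pull i _ (res e.le t)) = s
  rw [pull_res i e.le (i.preimage_mono e.le), ht, res_res]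
  exact (res_res _ _ (V := i ⁻¹ᵁ W) s).trans (res_self s)

/-- The ideal of sections on `Z` whose nonvanishing locus is an affine open of a thickening. -/
noncomputable def affineLocusIdeal {Z Y : Scheme.{u}} (i : Z ⟶ Y) [IsClosedImmersion i]
    [Surjective i] [IsAffine Z]
    (hsq : ∀ (U : Y.Opens) (s t : Γ(Y, U)), pull i U s = 0 → pull i U t = 0 → s * t = 0) :
    Ideal Γ(Z, ⊤) :=
  have smul_mem : ∀ (c g : Γ(Z, ⊤)), (∃ U : Y.Opens, IsAffineOpen U ∧ i ⁻¹ᵁ U = Z.basicOpen g) →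
      ∃ U : Y.Opens, IsAffineOpen U ∧ i ⁻¹ᵁ U = Z.basicOpen (c * g) := by
    rintro c g ⟨U, hU, e⟩
    obtain ⟨γ, hγ⟩ := pull_surjective i hU (res le_top c)
    refine ⟨Y.basicOpen γ, hU.basicOpen γ, ?_⟩
    rw [← basicOpen_pull, hγ, basicOpen_res, Scheme.basicOpen_mul, e, inf_comm]
  { carrier := {g | ∃ U : Y.Opens, IsAffineOpen U ∧ i ⁻¹ᵁ U = Z.basicOpen g}
    zero_mem' := ⟨⊥, isAffineOpen_bot Y, by simp⟩
    smul_mem' c g hg := smul_mem c g hg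
    add_mem' {g₁ g₂} hg₁ hg₂ := by
      obtain ⟨O, hO, hO'⟩ := i.isClosedEmbedding.isInducing.isOpen_iff.mp
        (Z.basicOpen (g₁ + g₂)).isOpen
      let W : Y.Opens := ⟨O, hO⟩
      have hW : i ⁻¹ᵁ W = Z.basicOpen (g₁ + g₂) := Opens.ext hO'
      -- Multiplying by `g₁ + g₂` shrinks both loci into `W`, over which `g₁ + g₂` is a unit and
      -- hence `g₁`, `g₂` are coprime.
      obtain ⟨U₁, hU₁, e₁⟩ := smul_mem (g₁ + g₂) g₁ hg₁
      obtain ⟨U₂, hU₂, e₂⟩ := smul_mem (g₁ + g₂) g₂ hg₂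
      rw [Scheme.basicOpen_mul] at e₁ e₂
      refine ⟨W, isAffineOpen_of_pull_surjective i ?_ (pull_surjective_of_sup_eq i hsq hU₁ hU₂ ?_
        (res le_top g₁) (res le_top g₂) ?_ ?_ ?_), hW⟩
      · rw [hW]
        exact (isAffineOpen_top Z).basicOpen _
      · refine eq_of_preimage_eq i ?_
        change i ⁻¹ᵁ U₁ ⊔ i ⁻¹ᵁ U₂ = _
        rw [e₁, e₂, hW, ← inf_sup_left, inf_eq_left]
        intro z hz
        by_contra h
        simp only [Opens.mem_sup, mem_basicOpen_iff_notMem_toSpecΓ, not_or, not_not] at hz h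
        exact hz (add_mem h.1 h.2)
      · have hu : IsUnit (res (le_top : i ⁻¹ᵁ W ≤ ⊤) (g₁ + g₂)) := by
          have h : IsUnit (res (Z.basicOpen_le (g₁ + g₂)) (g₁ + g₂)) :=
            RingedSpace.isUnit_res_basicOpen Z.toRingedSpace (g₁ + g₂)
          simpa only [res_res] using h.map (res hW.le)
        obtain ⟨v, hv⟩ := hu.exists_left_inv
        refine ⟨v, v, ?_⟩
        rw [← mul_add, ← map_add, hv]
      · rw [basicOpen_res, e₁, hW]
      · rw [basicOpen_res, e₂, hW] }

/-- A scheme is affine if it is a square zero thickening of an affine scheme. -/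
theorem isAffine_of_sq_zero {Z Y : Scheme.{u}} (i : Z ⟶ Y) [IsClosedImmersion i]
    [Surjective i] [IsAffine Z]
    (hsq : ∀ (U : Y.Opens) (s t : Γ(Y, U)), pull i U s = 0 → pull i U t = 0 → s * t = 0) :
    IsAffine Y := by
  -- Loci of members of this ideal cover `Z`, so it contains `1`, which says that `Y` itself is
  -- affine.
  have htop : affineLocusIdeal i hsq = ⊤ := by
    rw [← Ideal.span_eq (affineLocusIdeal i hsq), 
      ← (isAffineOpen_top Z).iSup_basicOpen_eq_self_iff, eq_top_iff]
    intro z _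
    obtain ⟨V, hV, hyV, -⟩ :=
      exists_isAffineOpen_mem_and_subset (X := Y) (x := i z) (U := ⊤) trivial
    obtain ⟨g, γ', e, hz⟩ := exists_basicOpen_le_affine_inter (isAffineOpen_top Z)
      (hV.preimage i) z ⟨trivial, hyV⟩
    obtain ⟨γ, rfl⟩ := pull_surjective i hV γ'
    rw [Opens.mem_iSup]
    refine ⟨⟨g, Y.basicOpen γ, hV.basicOpen γ, ?_⟩, hz⟩
    rw [e, basicOpen_pull]
  obtain ⟨U, hU, e⟩ := (Ideal.eq_top_iff_one _).mp htop
  obtain rfl : U = ⊤ := eq_of_preimage_eq i (by rw [e]; simp)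
  have : IsAffine (⊤ : Y.Opens).toScheme := hU
  exact .of_isIso Y.topIso.inv

/-! ### Compatible pairs of sections and closed covers -/

theorem exists_forall_res_eq {Y : Scheme.{u}} {ι : Type u} (U : ι → Y.Opens) (hU : ⨆ i, U i = ⊤)
    (s : ∀ i, Γ(Y, U i))
    (h : ∀ i j, res (inf_le_left : U i ⊓ U j ≤ U i) (s i) = res inf_le_right (s j)) :
    ∃ a : Γ(Y, ⊤), ∀ i, res le_top a = s i :=
  (Y.sheaf.existsUnique_gluing' U ⊤ (fun _ ↦ homOfLE le_top) hU.ge s h).exists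

theorem appTop_SpecMap_comp_fromSpec {Y : Scheme.{u}} {V : Y.Opens} (hV : IsAffineOpen V)
    {A : CommRingCat.{u}} (φ : Γ(Y, V) ⟶ A) (s : Γ(Y, ⊤)) :
    (Spec.map φ ≫ hV.fromSpec).appTop s = (Scheme.ΓSpecIso A).inv (φ (res le_top s)) := by
  have h1 : hV.fromSpec.appTop s = (Scheme.ΓSpecIso Γ(Y, V)).inv (res le_top s) := by
    have := congr($(hV.fromSpec_app_of_le ⊤ le_top) s)
    simp only [CommRingCat.comp_apply] at this
    exact this.trans (res_self _)
  rw [Scheme.Hom.comp_appTop, CommRingCat.comp_apply, h1]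
  exact congr($(Scheme.ΓSpecIso_inv_naturality φ) (res le_top s)).symm

/-- A pair of sections on `X` and on a closed subscheme `Z` of `Y` which agree on the fibre product
comes locally on `Y` from one section, up to the ideal generated by the equations of `Z`. -/
theorem exists_pull_sub_mem_map {X Y Z : Scheme.{u}} (f : X ⟶ Y) (i : Z ⟶ Y) [IsAffineHom f]
    [IsClosedImmersion i] {V : Y.Opens} (hV : IsAffineOpen V) (b : Γ(X, ⊤)) (c : Γ(Z, ⊤))
    (h : (pullback.fst f i).appTop b = (pullback.snd f i).appTop c) :
    ∃ r : Γ(Y, V), pull i V r = res le_top c ∧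
      pull f V r - res le_top b ∈ (RingHom.ker (pull i V)).map (pull f V) := by
  obtain ⟨r, hr⟩ := pull_surjective i hV (res le_top c)
  refine ⟨r, hr, ?_⟩
  set J := (RingHom.ker (pull i V)).map (pull f V)
  let π : Γ(X, f ⁻¹ᵁ V) →+* Γ(X, f ⁻¹ᵁ V) ⧸ J := Ideal.Quotient.mk J
  let σ : Γ(Z, i ⁻¹ᵁ V) →+* Γ(X, f ⁻¹ᵁ V) ⧸ J :=
    (Ideal.Quotient.lift _ (π.comp (pull f V)) fun a ha ↦
      Ideal.Quotient.eq_zero_iff_mem.mpr (Ideal.mem_map_of_mem _ ha)).comp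
      (RingHom.quotientKerEquivOfSurjective (pull_surjective i hV)).symm.toRingHom
  have hσ : ∀ t, σ (pull i V t) = π (pull f V t) := fun t ↦ by
    have : (RingHom.quotientKerEquivOfSurjective (pull_surjective i hV)).symm (pull i V t) =
        Ideal.Quotient.mk _ t := by
      rw [RingEquiv.symm_apply_eq]; rfl
    simp only [σ, RingHom.comp_apply, RingEquiv.toRingHom_eq_coe, RingHom.coe_coe, this]
    rfl
  -- The spectrum of the quotient by `J` maps to the fibre product; pulling `h` back along this map
  -- gives the congruence modulo `J`.
  have hfi : (Spec.map (CommRingCat.ofHom π) ≫ (hV.preimage f).fromSpec) ≫ f =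
      (Spec.map (CommRingCat.ofHom σ) ≫ (hV.preimage i).fromSpec) ≫ i := by
    rw [Category.assoc, Category.assoc, ← hV.SpecMap_appLE_fromSpec f (hV.preimage f) le_rfl,
      ← hV.SpecMap_appLE_fromSpec i (hV.preimage i) le_rfl, ← Spec.map_comp_assoc,
      ← Spec.map_comp_assoc, ← Scheme.Hom.app_eq_appLE, ← Scheme.Hom.app_eq_appLE]
    congr 2
    ext t
    exact (hσ t).symm
  have e₁ := congr(($(pullback.lift_fst _ _ hfi)).appTop b)
  have e₂ := congr(($(pullback.lift_snd _ _ hfi)).appTop c)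
  rw [appTop_SpecMap_comp_fromSpec, Scheme.Hom.comp_appTop, CommRingCat.comp_apply] at e₁ e₂
  rw [h] at e₁
  have e := (ConcreteCategory.injective_of_mono_of_preservesPullback
    (Scheme.ΓSpecIso (.of (Γ(X, f ⁻¹ᵁ V) ⧸ J))).inv) (e₁.symm.trans e₂)
  replace e : π (res le_top b) = σ (res le_top c) := e
  rw [← hr, hσ] at e
  exact Ideal.Quotient.eq.mp e.symm

theorem eq_of_pull_eq {X Y Z : Scheme.{u}} [IsReduced Y] (f : X ⟶ Y) (i : Z ⟶ Y)
    (hcov : ∀ y : Y, y ∈ Set.range f ∨ y ∈ Set.range i) {U : Y.Opens} {s t : Γ(Y, U)}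
    (h₁ : pull f U s = pull f U t) (h₂ : pull i U s = pull i U t) : s = t := by
  rw [← sub_eq_zero, ← basicOpen_eq_bot_iff, eq_bot_iff]
  intro y hy
  obtain ⟨x, rfl⟩ | ⟨z, rfl⟩ := hcov y
  · change x ∈ f ⁻¹ᵁ Y.basicOpen (s - t) at hy
    rw [← basicOpen_pull, map_sub, h₁, sub_self] at hy
    simp at hy
  · change z ∈ i ⁻¹ᵁ Y.basicOpen (s - t) at hy
    rw [← basicOpen_pull, map_sub, h₂, sub_self] at hy
    simp at hy

/-- Sections on two closed subschemes covering a reduced scheme glue. -/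
theorem exists_appTop_eq_of_isClosedImmersion {X Y Z : Scheme.{u}} [IsReduced Y] (f : X ⟶ Y)
    (i : Z ⟶ Y) [IsClosedImmersion f] [IsClosedImmersion i]
    (hcov : ∀ y : Y, y ∈ Set.range f ∨ y ∈ Set.range i) (b : Γ(X, ⊤)) (c : Γ(Z, ⊤))
    (h : (pullback.fst f i).appTop b = (pullback.snd f i).appTop c) :
    ∃ a : Γ(Y, ⊤), f.appTop a = b ∧ i.appTop a = c := by
  have loc : ∀ V : Y.affineOpens, ∃ s : Γ(Y, V.1), pull f V.1 s = res le_top b ∧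
      pull i V.1 s = res le_top c := by
    intro V
    obtain ⟨r, hr, hr'⟩ := exists_pull_sub_mem_map f i V.2 b c h
    -- As `f` is a closed immersion, the discrepancy lifts to some `t` vanishing on `Z`; subtracting
    -- it corrects `r` on `X` without changing it on `Z`.
    rw [Ideal.mem_map_iff_of_surjective _ (pull_surjective f V.2)] at hr'
    obtain ⟨t, ht, e⟩ := hr'
    refine ⟨r - t, ?_, ?_⟩
    · rw [map_sub, e, sub_sub_cancel]
    · rw [map_sub, hr, (RingHom.mem_ker).mp ht, sub_zero]
  choose s hs hs' using loc
  obtain ⟨a, ha⟩ := exists_forall_res_eq (fun V : Y.affineOpens ↦ V.1)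
    (iSup_affineOpens_eq_top Y) s (fun V W ↦ eq_of_pull_eq f i hcov
      (by rw [pull_res f inf_le_left (f.preimage_mono inf_le_left),
            pull_res f inf_le_right (f.preimage_mono inf_le_right), hs, hs, res_res, res_res])
      (by rw [pull_res i inf_le_left (i.preimage_mono inf_le_left),
            pull_res i inf_le_right (i.preimage_mono inf_le_right), hs', hs', res_res, res_res]))
  have key : ∀ {W : Scheme.{u}} (g : W ⟶ Y) (d : Γ(W, ⊤)),
      (∀ V : Y.affineOpens, pull g V.1 (s V) = res le_top d) → g.appTop a = d := by
    intro W g d hd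
    refine W.sheaf.eq_of_locally_eq' (fun V : Y.affineOpens ↦ g ⁻¹ᵁ V.1) ⊤
      (fun _ ↦ homOfLE le_top) ?_ _ _ fun V ↦ ?_
    · intro w _
      obtain ⟨V, hV, hw, -⟩ :=
        exists_isAffineOpen_mem_and_subset (X := Y) (x := g w) (U := ⊤) trivial
      exact Opens.mem_iSup.mpr ⟨⟨V, hV⟩, hw⟩
    · change res le_top (pull g ⊤ a) = res le_top d
      rw [← hd, ← ha, pull_res g le_top le_top]
      rfl
  exact ⟨a, key f b hs, key i c hs'⟩

theorem appTop_surjective_of_cover {X Y Z : Scheme.{u}} [IsReduced Y] (f : X ⟶ Y)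
    (i : Z ⟶ Y) [IsClosedImmersion f] [IsClosedImmersion i] [IsAffine Z]
    (hcov : ∀ y : Y, y ∈ Set.range f ∨ y ∈ Set.range i) : Function.Surjective f.appTop := by
  intro b
  obtain ⟨c, hc⟩ := appTop_surjective_of_isClosedImmersion (pullback.snd f i)
    ((pullback.fst f i).appTop b)
  obtain ⟨a, ha, -⟩ := exists_appTop_eq_of_isClosedImmersion f i hcov b c hc.symm
  exact ⟨a, ha⟩

/-- A reduced quasi-compact scheme that is the union of two affine closed subschemes is affine. -/
theorem isAffine_of_closed_cover {X Y Z : Scheme.{u}} [IsReduced Y] [CompactSpace Y] (f : X ⟶ Y)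
    (i : Z ⟶ Y) [IsClosedImmersion f] [IsClosedImmersion i] [IsAffine X] [IsAffine Z]
    (hcov : ∀ y : Y, y ∈ Set.range f ∨ y ∈ Set.range i) : IsAffine Y := by
  have : Y.IsQuasiAffine := by
    refine isQuasiAffine_of_forall_exists f i hcov fun b c h ↦ ?_
    obtain ⟨a, rfl, rfl⟩ := exists_appTop_eq_of_isClosedImmersion f i hcov b c h
    refine ⟨a, fun y ↦ ?_⟩
    rw [← Scheme.preimage_basicOpen_top, ← Scheme.preimage_basicOpen_top]
    refine ⟨fun hy ↦ ⟨fun x hx ↦ by subst hx; exact hy, fun z hz ↦ by subst hz; exact hy⟩,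
      fun ⟨h₁, h₂⟩ ↦ ?_⟩
    obtain ⟨x, rfl⟩ | ⟨z, rfl⟩ := hcov y
    · exact h₁ x rfl
    · exact h₂ z rfl
  have hf := appTop_surjective_of_cover f i hcov
  have hi := appTop_surjective_of_cover i f fun y ↦ (hcov y).symm
  refine isAffine_of_isQuasiAffine_of_range_union f i fun p ↦ ?_
  rw [range_comap_of_surjective _ _ hf, range_comap_of_surjective _ _ hi]
  -- The two kernels meet in zero because `Y` is reduced, so every prime contains one of them.
  refine (p.isPrime.inf_le (I := RingHom.ker f.appTop.hom) (J := RingHom.ker i.appTop.hom)).mp ?_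
  rintro a ⟨ha, ha'⟩
  obtain rfl : a = 0 := eq_of_pull_eq f i hcov (U := ⊤)
    (by rw [map_zero]; exact ha) (by rw [map_zero]; exact ha')
  exact zero_mem _

/-! ### Multiplication matrices, conductors and norms -/

section Norm

variable {R S K L : Type*} [CommRing R] [CommRing S] [Field K] [Field L] [Algebra K L]
  {φ : R →+* S} {α : R →+* K} {β : S →+* L}

open Matrix

/-- Module generators of `S` are integral over `K`, and the field they generate contains all
fractions of `S`. -/
theorem finiteDimensional_of_finite (hcomm : ∀ r, algebraMap K L (α r) = β (φ r)) (hφ : φ.Finite)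
    (hβ : ∀ l : L, ∃ s t : S, l = β s / β t) : FiniteDimensional K L := by
  let := φ.toAlgebra
  have : Module.Finite R S := hφ
  obtain ⟨G, hG⟩ := this.fg_top
  have hintegral : ∀ x ∈ β '' (G : Set S), _root_.IsIntegral K x := by
    rintro _ ⟨s, -, rfl⟩
    obtain ⟨p, hp, hp'⟩ := hφ.to_isIntegral s
    refine ⟨p.map α, hp.map α, ?_⟩
    rw [Polynomial.eval₂_map]
    have := congr(β $hp')
    rw [Polynomial.hom_eval₂, map_zero] at this
    rw [← this]
    congr 1
    ext r
    exact hcomm r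
  have : Finite (β '' (G : Set S)) := (G.finite_toSet.image β).to_subtype
  have hfd := IntermediateField.finiteDimensional_adjoin hintegral
  have hmem : ∀ s : S, β s ∈ IntermediateField.adjoin K (β '' (G : Set S)) := by
    intro s
    have hs : s ∈ Submodule.span R (G : Set S) := hG ▸ Submodule.mem_top
    induction hs using Submodule.span_induction with
    | mem x hx => exact IntermediateField.subset_adjoin K _ ⟨x, hx, rfl⟩
    | zero => rw [map_zero]; exact zero_mem _
    | add x y _ _ hx hy => rw [map_add]; exact add_mem hx hy
    | smul r x _ hx =>
      rw [Algebra.smul_def, map_mul]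
      refine mul_mem ?_ hx
      exact hcomm r ▸ IntermediateField.algebraMap_mem _ _
  have htop : IntermediateField.adjoin K (β '' (G : Set S)) = ⊤ := by
    rw [eq_top_iff]
    intro l _
    obtain ⟨s, t, rfl⟩ := hβ l
    exact div_mem (hmem s) (hmem t)
  rw [htop] at hfd
  exact IntermediateField.topEquiv.toLinearEquiv.finiteDimensional

variable {ι : Type*} [Fintype ι] [DecidableEq ι] (e : Module.Basis ι K L)

theorem leftMulMatrix_map_eq_smul (hcomm : ∀ r, algebraMap K L (α r) = β (φ r)) (r : R) (s : S) :
    Algebra.leftMulMatrix e (β (φ r * s)) = α r • Algebra.leftMulMatrix e (β s) := by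
  rw [map_mul, ← hcomm, ← Algebra.smul_def, map_smul]

/-- The matrices of multiplication by elements of a finite algebra have a common denominator. -/
theorem exists_denominator (hcomm : ∀ r, algebraMap K L (α r) = β (φ r)) (hφ : φ.Finite)
    (hα : Function.Injective α) (hα' : ∀ k : K, ∃ s t : R, k = α s / α t) :
    ∃ t : R, t ≠ 0 ∧ ∀ (s : S) (j k : ι),
      α t * Algebra.leftMulMatrix e (β s) j k ∈ α.range := by
  let := φ.toAlgebra
  have : Module.Finite R S := hφ
  obtain ⟨G, hG⟩ := this.fg_top
  have hden : ∀ F : Finset K, ∃ t : R, t ≠ 0 ∧ ∀ x ∈ F, α t * x ∈ α.range := by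
    have : IsDomain R := hα.isDomain α
    classical
    intro F
    induction F using Finset.induction_on with
    | empty => exact ⟨1, one_ne_zero, by simp⟩
    | insert x F _ ih =>
      obtain ⟨t, ht, ht'⟩ := ih
      obtain ⟨a, b, hab⟩ := hα' x
      obtain ⟨b', hb', hab'⟩ : ∃ b' : R, b' ≠ 0 ∧ α b' * x ∈ α.range := by
        by_cases hb : b = 0
        · exact ⟨1, one_ne_zero, 0, by simp [hab, hb]⟩
        · refine ⟨b, hb, a, ?_⟩
          rw [hab, mul_div_cancel₀]
          rwa [ne_eq, map_eq_zero_iff α hα]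
      refine ⟨t * b', mul_ne_zero ht hb', fun y hy ↦ ?_⟩
      obtain rfl | hy := Finset.mem_insert.mp hy
      · rw [map_mul, mul_assoc]
        exact mul_mem ⟨t, rfl⟩ hab'
      · rw [mul_comm, map_mul, mul_comm (α t), mul_left_comm, mul_comm y]
        exact mul_mem ⟨b', rfl⟩ (ht' y hy)
  classical
  obtain ⟨t, ht, ht'⟩ := hden ((G ×ˢ (Finset.univ : Finset (ι × ι))).image
    fun x ↦ Algebra.leftMulMatrix e (β x.1) x.2.1 x.2.2)
  refine ⟨t, ht, fun s ↦ ?_⟩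
  have hs : s ∈ Submodule.span R (G : Set S) := hG ▸ Submodule.mem_top
  induction hs using Submodule.span_induction with
  | mem x hx =>
    exact fun j k ↦ ht' _ (Finset.mem_image.mpr ⟨(x, j, k), by simpa using hx, rfl⟩)
  | zero => intro j k; simp
  | add x y _ _ hx hy =>
    intro j k
    rw [map_add, map_add, Matrix.add_apply, mul_add]
    exact add_mem (hx j k) (hy j k)
  | smul r x _ hx =>
    intro j k
    rw [Algebra.smul_def, RingHom.algebraMap_toAlgebra, leftMulMatrix_map_eq_smul e hcomm,
      Matrix.smul_apply, smul_eq_mul, mul_left_comm]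
    exact mul_mem ⟨r, rfl⟩ (hx j k)

variable {D : Ideal R}

/-- This is why `D` is squared: one factor clears the denominators, the other keeps the entries in
`D`. -/
theorem exists_matrix_of_mem_map (hcomm : ∀ r, algebraMap K L (α r) = β (φ r))
    (hD : ∀ d ∈ D, ∀ (s : S) (j k : ι), α d * Algebra.leftMulMatrix e (β s) j k ∈ α.range)
    {v : S} (hv : v ∈ (D * D).map φ) :
    ∃ N : Matrix ι ι R, (∀ j k, N j k ∈ D) ∧ N.map α = Algebra.leftMulMatrix e (β v) := by
  have hadd : ∀ x y : S,
      (∃ N : Matrix ι ι R, (∀ j k, N j k ∈ D) ∧ N.map α = Algebra.leftMulMatrix e (β x)) →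
      (∃ N : Matrix ι ι R, (∀ j k, N j k ∈ D) ∧ N.map α = Algebra.leftMulMatrix e (β y)) →
      ∃ N : Matrix ι ι R, (∀ j k, N j k ∈ D) ∧ N.map α = Algebra.leftMulMatrix e (β (x + y)) := by
    rintro x y ⟨N, hN, hN'⟩ ⟨P, hP, hP'⟩
    refine ⟨N + P, fun j k ↦ add_mem (hN j k) (hP j k), ?_⟩
    rw [map_add, map_add, ← hN', ← hP', Matrix.map_add α (map_add α)]
  -- The extra factor `s` absorbs the coefficients from `S` in the span induction.
  suffices ∀ s : S, ∃ N : Matrix ι ι R, (∀ j k, N j k ∈ D) ∧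
      N.map α = Algebra.leftMulMatrix e (β (v * s)) by simpa using this 1
  induction hv using Submodule.span_induction with
  | mem x hx =>
    obtain ⟨w, hw, rfl⟩ := hx
    intro s
    induction hw using Submodule.mul_induction_on' with
    | mem_mul_mem d hd d' hd' =>
      choose N hN using hD d' hd' s
      refine ⟨Matrix.of fun j k ↦ d * N j k, fun j k ↦ D.mul_mem_right _ hd, ?_⟩
      rw [map_mul φ, mul_assoc, leftMulMatrix_map_eq_smul e hcomm, leftMulMatrix_map_eq_smul e hcomm]
      ext j k
      simp [hN]
    | add x _ y _ hx hy =>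
      rw [map_add, add_mul]
      exact hadd _ _ hx hy
  | zero => exact fun s ↦ ⟨0, fun j k ↦ zero_mem _, by ext; simp⟩
  | add x y _ _ hx hy =>
    intro s
    rw [add_mul]
    exact hadd _ _ (hx s) (hy s)
  | smul a x _ hx =>
    intro s
    rw [smul_eq_mul, mul_comm a, mul_assoc]
    exact hx _

theorem exists_matrix_of_sub_mem_map (hcomm : ∀ r, algebraMap K L (α r) = β (φ r))
    (hD : ∀ d ∈ D, ∀ (s : S) (j k : ι), α d * Algebra.leftMulMatrix e (β s) j k ∈ α.range)
    {b : S} {r : R} (hb : φ r - b ∈ (D * D).map φ) :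
    ∃ N : Matrix ι ι R, (∀ j k, (r • (1 : Matrix ι ι R) - N) j k ∈ D) ∧
      N.map α = Algebra.leftMulMatrix e (β b) := by
  obtain ⟨N, hN, hN'⟩ := exists_matrix_of_mem_map e hcomm hD hb
  refine ⟨r • 1 - N, fun j k ↦ by simpa using hN j k, ?_⟩
  have h1 : Algebra.leftMulMatrix e (β (φ r)) = α r • 1 := by
    rw [← mul_one (φ r), leftMulMatrix_map_eq_smul e hcomm, map_one, map_one]
  rw [Matrix.map_sub α (map_sub α), hN', map_sub, map_sub, h1, sub_eq_iff_eq_add,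
    add_sub_cancel]
  ext j k
  simp [Matrix.one_apply, apply_ite α]

/-- The norm of an element that is integral over `R` modulo a conductor does not vanish at a prime
if the element does not vanish at any prime above it. -/
theorem det_notMem_of_forall_notMem (hcomm : ∀ r, algebraMap K L (α r) = β (φ r))
    (hφ : φ.IsIntegral) (hα : Function.Injective α)
    (hD : ∀ d ∈ D, ∀ (s : S) (j k : ι), α d * Algebra.leftMulMatrix e (β s) j k ∈ α.range)
    {b : S} {r : R} (hb : φ r - b ∈ (D * D).map φ) {N : Matrix ι ι R}
    (hN : ∀ j k, (r • (1 : Matrix ι ι R) - N) j k ∈ D)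
    (hN' : N.map α = Algebra.leftMulMatrix e (β b)) (q : Ideal R) [q.IsPrime]
    (hq : ∀ P : Ideal S, P.IsPrime → P.comap φ = q → b ∉ P) : N.det ∉ q := by
  let := φ.toAlgebra
  have : Algebra.IsIntegral R S := ⟨hφ⟩
  intro hdet
  by_cases hDq : D ≤ q
  -- Modulo `q` the matrix is the scalar `r`, so its determinant is a power of `r`; then `b` lies in
  -- any prime above `q`.
  · have hr : r ∈ q := by
      have h1 : (Ideal.Quotient.mk q) N.det = (Ideal.Quotient.mk q r) ^ Fintype.card ι := by
        have h2 : (Ideal.Quotient.mk q).mapMatrix N = Ideal.Quotient.mk q r • 1 := by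
          ext j k
          have h3 := Ideal.Quotient.eq_zero_iff_mem.mpr (hDq (hN j k))
          rw [Matrix.sub_apply, map_sub, sub_eq_zero] at h3
          rw [RingHom.mapMatrix_apply, Matrix.map_apply, ← h3]
          by_cases hjk : j = k <;> simp [hjk]
        rw [RingHom.map_det, h2, Matrix.det_smul, Matrix.det_one, mul_one]
      rw [Ideal.Quotient.eq_zero_iff_mem.mpr hdet] at h1
      exact Ideal.IsPrime.mem_of_pow_mem ‹_› _
        (Ideal.Quotient.eq_zero_iff_mem.mp ((map_pow _ _ _).trans h1.symm))
    have hker : (⊥ : Ideal S).comap (algebraMap R S) ≤ q := by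
      intro x hx
      have : α x = 0 := by
        rw [← map_eq_zero (algebraMap K L), hcomm, show φ x = 0 from hx, map_zero]
      rw [(map_eq_zero_iff α hα).mp this]
      exact zero_mem _
    obtain ⟨P, -, hP, hPq⟩ := Ideal.exists_ideal_over_prime_of_isIntegral q ⊥ hker
    refine hq P hP hPq ?_
    have h4 : φ r - b ∈ P := by
      refine Ideal.map_le_iff_le_comap.mpr ?_ hb
      exact (Ideal.mul_le_right.trans hDq).trans hPq.ge
    have h5 : φ r ∈ P := hPq.ge hr
    exact (Submodule.sub_mem_iff_right _ h5).mp h4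
  -- Away from `D`, some multiple `b * s = φ g` has `g ∉ q`. The matrix of `z * z * s` is integral
  -- and inverts `N` up to the scalar `z * z * g ∉ q`.
  · obtain ⟨z, hz, hzq⟩ := SetLike.not_le_iff_exists.mp hDq
    have hcom : ¬ (Ideal.span {b}).comap (algebraMap R S) ≤ q := by
      intro h
      obtain ⟨P, hbP, hP, hPq⟩ := Ideal.exists_ideal_over_prime_of_isIntegral q _ h
      exact hq P hP hPq (hbP (Ideal.mem_span_singleton_self b))
    obtain ⟨g, hg, hgq⟩ := SetLike.not_le_iff_exists.mp hcom
    obtain ⟨s, hs⟩ := Ideal.mem_span_singleton.mp (Ideal.mem_comap.mp hg)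
    replace hs : φ g = b * s := hs
    obtain ⟨P, -, hP'⟩ := exists_matrix_of_mem_map e hcomm hD (v := φ (z * z) * s)
      (Ideal.mul_mem_right _ _ (Ideal.mem_map_of_mem _ (Ideal.mul_mem_mul hz hz)))
    have hprod : N * P = (z * z * g) • 1 := by
      refine Matrix.map_injective hα ?_
      have h1 : Algebra.leftMulMatrix e (β (φ (z * z * g) * 1)) = α (z * z * g) • 1 := by
        rw [leftMulMatrix_map_eq_smul e hcomm, map_one, map_one]
      change (N * P).map α = ((z * z * g) • (1 : Matrix ι ι R)).map α
      rw [Matrix.map_mul, hN', hP', ← map_mul, ← map_mul, mul_left_comm, ← hs, ← map_mul,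
        ← mul_one (φ _), h1]
      ext j k
      simp [Matrix.one_apply, apply_ite α]
    have hdet2 : N.det * P.det = (z * z * g) ^ Fintype.card ι := by
      rw [← Matrix.det_mul, hprod, Matrix.det_smul, Matrix.det_one, mul_one]
    have hmem : (z * z * g) ^ Fintype.card ι ∈ q := hdet2 ▸ q.mul_mem_right _ hdet
    have := Ideal.IsPrime.mem_of_pow_mem ‹_› _ hmem
    rcases Ideal.IsPrime.mem_or_mem ‹q.IsPrime› this with h | h
    · exact hzq ((Ideal.IsPrime.mem_or_mem ‹q.IsPrime› h).elim id id)
    · exact hgq h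

end Norm

/-! ### Function fields and the integral case -/

theorem map_genericPoint {X Y : Scheme.{u}} [IrreducibleSpace X] [IrreducibleSpace Y] (f : X ⟶ Y)
    [Surjective f] : f (genericPoint X) = genericPoint Y := by
  have h := (genericPoint_spec X).image f.continuous
  rw [Set.image_univ, f.surjective.range_eq, closure_univ] at h
  exact h.eq (genericPoint_spec Y)

/-- The germ at the generic point. -/
noncomputable def germη {Y : Scheme.{u}} [IrreducibleSpace Y] {V : Y.Opens}
    (hV : genericPoint Y ∈ V) : Γ(Y, V) →+* Y.functionField :=
  (Y.presheaf.germ V (genericPoint Y) hV).hom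

theorem genericPoint_mem {Y : Scheme.{u}} [IrreducibleSpace Y] {V : Y.Opens} {y : Y}
    (hy : y ∈ V) : genericPoint Y ∈ V :=
  ((genericPoint_spec Y).mem_open_set_iff V.isOpen).mpr ⟨y, trivial, hy⟩

theorem germη_res {Y : Scheme.{u}} [IrreducibleSpace Y] {U V : Y.Opens}
    (hU : genericPoint Y ∈ U) (hUV : U ≤ V) (s : Γ(Y, V)) :
    germη hU (res hUV s) = germη (hUV hU) s :=
  Y.presheaf.germ_res_apply (homOfLE hUV) _ hU s

theorem germη_injective {Y : Scheme.{u}} [IsIntegral Y] {V : Y.Opens}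
    (hV : genericPoint Y ∈ V) : Function.Injective (germη hV) :=
  germ_injective_of_isIntegral _ _ _

theorem exists_eq_germη_div {Y : Scheme.{u}} [IsIntegral Y] {V : Y.Opens} (hV : IsAffineOpen V)
    (hη : genericPoint Y ∈ V) (k : Y.functionField) :
    ∃ s t : Γ(Y, V), k = germη hη s / germη hη t := by
  have : Nonempty V := ⟨⟨_, hη⟩⟩
  have := functionField_isFractionRing_of_isAffineOpen Y V hV
  obtain ⟨s, t, -, h⟩ := IsFractionRing.div_surjective Γ(Y, V) k
  exact ⟨s, t, h.symm⟩

/-- The map of function fields induced by a surjective morphism. -/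
noncomputable def functionFieldMap {X Y : Scheme.{u}} [IrreducibleSpace X] [IrreducibleSpace Y]
    (f : X ⟶ Y) [Surjective f] : Y.functionField →+* X.functionField :=
  (Y.presheaf.stalkSpecializes (specializes_of_eq (map_genericPoint f)) ≫
    f.stalkMap (genericPoint X)).hom

theorem genericPoint_mem_preimage {X Y : Scheme.{u}} [IrreducibleSpace X] [IrreducibleSpace Y]
    (f : X ⟶ Y) [Surjective f] {V : Y.Opens} (hV : genericPoint Y ∈ V) :
    genericPoint X ∈ f ⁻¹ᵁ V := by
  change f _ ∈ V
  rwa [map_genericPoint]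

theorem functionFieldMap_germη {X Y : Scheme.{u}} [IrreducibleSpace X] [IrreducibleSpace Y]
    (f : X ⟶ Y) [Surjective f] {V : Y.Opens} (hV : genericPoint Y ∈ V) (s : Γ(Y, V)) :
    functionFieldMap f (germη hV s) = germη (genericPoint_mem_preimage f hV) (pull f V s) := by
  have := congr($(Y.presheaf.germ_stalkSpecializes hV
    (specializes_of_eq (map_genericPoint f))) s)
  simp only [CommRingCat.comp_apply] at this
  change f.stalkMap (genericPoint X) (Y.presheaf.stalkSpecializes _ (Y.presheaf.germ _ _ hV s)) = _
  rw [this]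
  exact f.germ_stalkMap_apply V (genericPoint X) _ s

/-- A rational function on an integral scheme that is regular on each member of an open cover is
a global section. -/
theorem mem_range_germη_top {Y : Scheme.{u}} [IsIntegral Y] {ι : Type u} (V : ι → Y.Opens)
    (hV : ⨆ i, V i = ⊤) (hη : ∀ i, genericPoint Y ∈ V i) (k : Y.functionField)
    (hk : ∀ i, k ∈ (germη (hη i)).range) :
    k ∈ (germη (V := (⊤ : Y.Opens)) trivial).range := by
  choose s hs using hk
  obtain ⟨a, ha⟩ := exists_forall_res_eq V hV s (fun i j ↦ germη_injective
    (V := V i ⊓ V j) (Opens.mem_inf.mpr ⟨hη i, hη j⟩) (by rw [germη_res, germη_res, hs, hs]))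
  have hmem : genericPoint Y ∈ ⨆ i, V i := by rw [hV]; trivial
  obtain ⟨i, -⟩ := Opens.mem_iSup.mp hmem
  refine ⟨a, ?_⟩
  rw [← hs i, ← ha i, germη_res]

theorem mem_basicOpen_iff_notMem_primeIdealOf {Y : Scheme.{u}} {V : Y.Opens} (hV : IsAffineOpen V)
    {y : Y} (hy : y ∈ V) (s : Γ(Y, V)) :
    y ∈ Y.basicOpen s ↔ s ∉ (hV.primeIdealOf ⟨y, hy⟩).asIdeal := by
  conv_lhs => rw [← show _ = y from hV.fromSpec_primeIdealOf ⟨y, hy⟩]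
  change hV.primeIdealOf ⟨y, hy⟩ ∈ hV.fromSpec ⁻¹ᵁ Y.basicOpen s ↔ _
  rw [hV.fromSpec_preimage_basicOpen]
  rfl

theorem exists_eq_of_comap_pull_eq {X Y : Scheme.{u}} (f : X ⟶ Y) [IsAffineHom f] {V : Y.Opens}
    (hV : IsAffineOpen V) {y : Y} (hy : y ∈ V) (P : Ideal Γ(X, f ⁻¹ᵁ V)) (hP : P.IsPrime)
    (h : P.comap (pull f V) = (hV.primeIdealOf ⟨y, hy⟩).asIdeal) :
    ∃ x : X, f x = y ∧ ∀ s : Γ(X, f ⁻¹ᵁ V), x ∈ X.basicOpen s ↔ s ∉ P := by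
  refine ⟨(hV.preimage f).fromSpec ⟨P, hP⟩, ?_, fun s ↦ ?_⟩
  · have e : Spec.map (f.app V) ≫ hV.fromSpec = (hV.preimage f).fromSpec ≫ f := by
      rw [Scheme.Hom.app_eq_appLE, hV.SpecMap_appLE_fromSpec f (hV.preimage f) le_rfl]
    refine congr($e (⟨P, hP⟩ : PrimeSpectrum _)).symm.trans ?_
    refine Eq.trans ?_ (hV.fromSpec_primeIdealOf ⟨y, hy⟩)
    have hpt : PrimeSpectrum.comap (f.app V).hom ⟨P, hP⟩ = hV.primeIdealOf ⟨y, hy⟩ :=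
      PrimeSpectrum.ext h
    exact congrArg hV.fromSpec hpt
  · change (⟨P, hP⟩ : PrimeSpectrum _) ∈ (hV.preimage f).fromSpec ⁻¹ᵁ X.basicOpen s ↔ _
    rw [(hV.preimage f).fromSpec_preimage_basicOpen]
    rfl

theorem exists_finite_affine_cover (Y : Scheme.{u}) [CompactSpace Y] :
    ∃ (ι : Type u) (_ : Finite ι) (V : ι → Y.affineOpens), (⨆ i, (V i).1 = ⊤) ∧
      ∀ i, ((V i).1 : Set Y).Nonempty := by
  choose V hV hy _ using fun y : Y ↦
    exists_isAffineOpen_mem_and_subset (X := Y) (x := y) (U := ⊤) trivial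
  obtain ⟨t, ht⟩ := isCompact_univ.elim_finite_subcover (fun y ↦ (V y : Set Y))
    (fun y ↦ (V y).isOpen) (fun y _ ↦ Set.mem_iUnion.mpr ⟨y, hy y⟩)
  refine ⟨t, inferInstance, fun y ↦ ⟨V y, hV y⟩, ?_, fun y ↦ ⟨y, hy y⟩⟩
  rw [eq_top_iff]
  intro y _
  obtain ⟨z, hz, hyz⟩ := Set.mem_iUnion₂.mp (ht (Set.mem_univ y))
  exact Opens.mem_iSup.mpr ⟨⟨z, hz⟩, hyz⟩

/-- Nonzero sections on the members of a finite affine cover of an integral noetherian scheme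
divide all sections of some nonzero ideal sheaf. -/
theorem exists_idealSheafData_le_span {Y : Scheme.{u}} [IsIntegral Y] [IsLocallyNoetherian Y]
    {ι : Type u} [Finite ι] (V : ι → Y.affineOpens) (hη : ∀ i, genericPoint Y ∈ (V i).1)
    (t : ∀ i, Γ(Y, (V i).1)) (ht : ∀ i, t i ≠ 0) :
    ∃ D : Y.IdealSheafData, genericPoint Y ∉ D.support ∧
      ∀ i, D.ideal (V i) ≤ Ideal.span {t i} := by
  let U : Y.Opens := ⟨⋂ i, (Y.basicOpen (t i) : Set Y),
    isOpen_iInter_of_finite fun i ↦ (Y.basicOpen (t i)).isOpen⟩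
  have hU : ∀ i, U ≤ Y.basicOpen (t i) := fun i ↦ Set.iInter_subset _ i
  have hηU : genericPoint Y ∈ U := by
    refine Set.mem_iInter.mpr fun i ↦ ?_
    rw [SetLike.mem_coe, Scheme.mem_basicOpen _ _ _ (hη i)]
    have : germη (hη i) (t i) ≠ 0 := (map_ne_zero_iff _ (germη_injective (hη i))).mpr (ht i)
    exact isUnit_iff_ne_zero.mpr this
  let T : Closeds Y := U.compl
  let I := Scheme.IdealSheafData.vanishingIdeal T
  have hI : ∀ i, I.ideal (V i) ≤ (Ideal.span {t i}).radical := by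
    intro i
    rw [Scheme.IdealSheafData.vanishingIdeal_ideal,
      ← PrimeSpectrum.vanishingIdeal_zeroLocus_eq_radical]
    refine PrimeSpectrum.vanishingIdeal_anti_mono fun p hp ↦ ?_
    change (V i).2.fromSpec p ∉ U
    intro h
    have h1 : p ∈ (V i).2.fromSpec ⁻¹ᵁ Y.basicOpen (t i) := hU i h
    rw [(V i).2.fromSpec_preimage_basicOpen] at h1
    exact h1 (hp (Ideal.mem_span_singleton_self _))
  have hpow : ∀ i, ∃ n : ℕ, I.ideal (V i) ^ n ≤ Ideal.span {t i} := fun i ↦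
    have : IsNoetherianRing Γ(Y, (V i).1) := IsLocallyNoetherian.component_noetherian (V i)
    Ideal.exists_pow_le_of_le_radical_of_fg (hI i) (Ideal.fg_of_isNoetherianRing _)
  choose n hn using hpow
  obtain ⟨N, hN⟩ := Finite.bddAbove_range n
  -- `N` bounds the exponents of the finitely many charts; the successor makes the exponent nonzero,
  -- so the support is unchanged.
  refine ⟨I ^ (N + 1), ?_, fun i ↦ ?_⟩
  · rw [Scheme.IdealSheafData.support_pow _ _ N.succ_ne_zero]
    change genericPoint Y ∉ (T : Set Y)
    exact fun h ↦ h hηU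
  · rw [Scheme.IdealSheafData.ideal_pow]
    exact (Ideal.pow_le_pow_right ((hN ⟨i, rfl⟩).trans N.le_succ)).trans (hn i)

/-- A global section of `X` is bounded by the norm: its characteristic polynomial over the
function field of `Y` descends to `Y`. -/
theorem exists_monic_of_agree {X Y : Scheme.{u}} [IsIntegral X] [IsIntegral Y] (f : X ⟶ Y)
    [IsFinite f] [Surjective f] [Algebra Y.functionField X.functionField]
    (hff : algebraMap Y.functionField X.functionField = functionFieldMap f)
    {κ : Type*} [Fintype κ] [DecidableEq κ]
    (e : Module.Basis κ Y.functionField X.functionField)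
    {ι : Type u} (V : ι → Y.affineOpens) (hV : ⨆ i, (V i).1 = ⊤)
    (hη : ∀ i, genericPoint Y ∈ (V i).1) (D : Y.IdealSheafData)
    (hD : ∀ i, ∀ d ∈ D.ideal (V i), ∀ (s : Γ(X, f ⁻¹ᵁ (V i).1)) (j k : κ),
      germη (hη i) d * Algebra.leftMulMatrix e
        (germη (genericPoint_mem_preimage f (hη i)) s) j k ∈ (germη (hη i)).range)
    (b : Γ(X, ⊤)) (c : Γ((D * D).subscheme, ⊤))
    (h : (pullback.fst f (D * D).subschemeι).appTop b =
      (pullback.snd f (D * D).subschemeι).appTop c) :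
    ∃ p : Polynomial Γ(Y, ⊤), p.Monic ∧ p.eval₂ f.appTop.hom b = 0 ∧
      ∀ y : Y, (∀ x : X, f x = y → x ∈ X.basicOpen b) → y ∈ Y.basicOpen (p.coeff 0) := by
  have hcomm : ∀ i, ∀ r : Γ(Y, (V i).1), algebraMap Y.functionField X.functionField
      (germη (hη i) r) = germη (genericPoint_mem_preimage f (hη i)) (pull f (V i).1 r) := by
    intro i r
    rw [hff, functionFieldMap_germη]
  have hr : ∀ i, ∃ r : Γ(Y, (V i).1), pull f (V i).1 r - res le_top b ∈
      (D.ideal (V i) * D.ideal (V i)).map (pull f (V i).1) := by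
    intro i
    obtain ⟨r, -, hr⟩ := exists_pull_sub_mem_map f (D * D).subschemeι (V i).2 b c h
    have hker : RingHom.ker (pull (D * D).subschemeι (V i).1) = (D * D).ideal (V i) :=
      (D * D).ker_subschemeι_app (V i)
    rw [hker] at hr
    exact ⟨r, hr⟩
  choose r hr using hr
  choose N hN hN' using fun i ↦ exists_matrix_of_sub_mem_map e (hcomm i) (hD i) (hr i)
  set M := Algebra.leftMulMatrix e (germη (V := (⊤ : X.Opens)) trivial b) with hM
  replace hN' : ∀ i, (N i).map (germη (hη i)) = M := by
    intro i
    rw [hN', germη_res]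
  -- On each chart the coefficients are those of the integral matrix `N i`, so they are regular
  -- everywhere.
  have hlifts : M.charpoly ∈ Polynomial.lifts (germη (V := (⊤ : Y.Opens)) trivial) := by
    rw [Polynomial.lifts_iff_coeff_lifts]
    intro n
    refine mem_range_germη_top (fun i ↦ (V i).1) hV hη _ fun i ↦ ⟨(N i).charpoly.coeff n, ?_⟩
    rw [← Polynomial.coeff_map, ← Matrix.charpoly_map, hN']
  obtain ⟨p, hp, -, hpm⟩ := Polynomial.lifts_and_natDegree_eq_and_monic hlifts
    (Matrix.charpoly_monic _)
  refine ⟨p, hpm, ?_, fun y hy ↦ ?_⟩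
  · refine germη_injective (V := (⊤ : X.Opens)) trivial ?_
    rw [map_zero, Polynomial.hom_eval₂]
    have h1 : (germη (V := (⊤ : X.Opens)) trivial).comp f.appTop.hom =
        (algebraMap Y.functionField X.functionField).comp
          (germη (V := (⊤ : Y.Opens)) trivial) := by
      ext s
      rw [RingHom.comp_apply, RingHom.comp_apply, hff]
      exact (functionFieldMap_germη f (V := (⊤ : Y.Opens)) trivial s).symm
    rw [h1, ← Polynomial.eval₂_map, hp]
    refine Algebra.leftMulMatrix_injective e ?_
    rw [map_zero, ← Polynomial.aeval_def, ← Polynomial.aeval_algHom_apply]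
    exact Matrix.aeval_self_charpoly _
  · have hmem : y ∈ ⨆ i, (V i).1 := by rw [hV]; trivial
    obtain ⟨i, hi⟩ := Opens.mem_iSup.mp hmem
    have hdet : res le_top (p.coeff 0) = (-1) ^ Fintype.card κ * (N i).det := by
      refine germη_injective (hη i) ?_
      rw [germη_res, ← Polynomial.coeff_map, hp, map_mul, map_pow, map_neg, map_one,
        RingHom.map_det, RingHom.mapMatrix_apply, hN', Matrix.det_eq_sign_charpoly_coeff,
        ← mul_assoc, ← mul_pow]
      simp
    suffices hb : y ∈ Y.basicOpen (res (le_top : (V i).1 ≤ ⊤) (p.coeff 0)) by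
      rw [basicOpen_res] at hb
      exact hb.2
    rw [mem_basicOpen_iff_notMem_primeIdealOf (V i).2 hi, hdet]
    have key := det_notMem_of_forall_notMem e (hcomm i)
      ((f.finite_app (V i).1 (V i).2).to_isIntegral) (germη_injective (hη i)) (hD i) (hr i)
      (hN i) (by rw [hN', germη_res]) ((V i).2.primeIdealOf ⟨y, hi⟩).asIdeal (by
        intro P hP hPy
        obtain ⟨x, rfl, hx⟩ := exists_eq_of_comap_pull_eq f (V i).2 hi P hP hPy
        rw [← hx, basicOpen_res]
        exact ⟨hi, hy x rfl⟩)
    intro hmem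
    exact key ((Ideal.unit_mul_mem_iff_mem _ (isUnit_one.neg.pow _)).mp hmem)

/-- Integrality of `B` over `A` can be tested on the fibre product of `B` and `C` over `P`. -/
theorem isIntegral_of_forall_agree {A B C P : Type*} [CommRing A] [CommRing B] [CommRing C]
    [CommRing P] (φ : A →+* B) (g : B →+* P) (h : C →+* P) (hg : Function.Surjective g)
    (hh : h.IsIntegral) (H : ∀ b c, g b = h c → φ.IsIntegralElem b) : φ.IsIntegral := by
  let := φ.toAlgebra
  intro b
  change _root_.IsIntegral A b
  cases subsingleton_or_nontrivial B
  · exact Subsingleton.elim 0 b ▸ isIntegral_zero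
  obtain ⟨q, hq, hqb⟩ := hh (g b)
  let S := integralClosure A B
  have hlift : q.map h ∈ Polynomial.lifts (g.comp S.val.toRingHom) := by
    rw [Polynomial.lifts_iff_coeff_lifts]
    intro n
    obtain ⟨b', hb'⟩ := hg (h (q.coeff n))
    -- Each lifted coefficient agrees on `P` with one from `C`, so it is integral over `A`.
    exact ⟨⟨b', H b' _ hb'⟩, by rw [Polynomial.coeff_map]; exact hb'⟩
  obtain ⟨p, hp, -, hpm⟩ := Polynomial.lifts_and_natDegree_eq_and_monic hlift (hq.map h)
  have hpb : g (Polynomial.aeval b p) = 0 := by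
    rw [Polynomial.aeval_def, Polynomial.hom_eval₂, ← hqb, ← Polynomial.eval_map h, ← hp,
      Polynomial.eval_map]
    rfl
  have hub : _root_.IsIntegral A (b * Polynomial.aeval b p) :=
    H _ 0 (by rw [map_mul, hpb, mul_zero, map_zero])
  have : _root_.IsIntegral S b := by
    -- The factor `X` makes the degree positive, so subtracting a constant leaves a monic polynomial
    -- even for `p = 1`.
    refine ⟨Polynomial.X * p - Polynomial.C ⟨_, hub⟩, ?_, ?_⟩
    · refine (Polynomial.monic_X.mul hpm).sub_of_left ?_
      rw [Polynomial.degree_mul' (by simp [hpm.leadingCoeff])]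
      refine Polynomial.degree_C_le.trans_lt ?_
      rw [Polynomial.degree_X, Polynomial.degree_eq_natDegree hpm.ne_zero]
      exact_mod_cast Nat.lt_of_lt_of_le Nat.zero_lt_one (Nat.le_add_right 1 _)
    · rw [Polynomial.eval₂_sub, Polynomial.eval₂_mul, Polynomial.eval₂_X, Polynomial.eval₂_C]
      exact sub_self _
  exact isIntegral_trans (R := A) (A := S) b this

/-- The equation exhibits the pulled back constant coefficient as a multiple of `b`. -/
theorem mem_basicOpen_of_eval₂_eq_zero {X Y : Scheme.{u}} (f : X ⟶ Y) (p : Polynomial Γ(Y, ⊤))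
    (b : Γ(X, ⊤)) (hp : p.eval₂ f.appTop.hom b = 0) (x : X) (hx : f x ∈ Y.basicOpen (p.coeff 0)) :
    x ∈ X.basicOpen b := by
  rw [← Polynomial.divX_mul_X_add p, Polynomial.eval₂_add, Polynomial.eval₂_mul,
    Polynomial.eval₂_X, Polynomial.eval₂_C] at hp
  have h1 : x ∈ X.basicOpen (f.appTop.hom (p.coeff 0)) := by
    change x ∈ X.basicOpen (f.app ⊤ _)
    rw [← Scheme.preimage_basicOpen]
    exact hx
  rw [← neg_eq_of_add_eq_zero_right hp, ← neg_mul, Scheme.basicOpen_mul] at h1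
  exact h1.2

/-- Lying over applies to every prime because the kernel on global sections is nil. -/
theorem mem_range_comap_of_isIntegral {X Y : Scheme.{u}} (f : X ⟶ Y) [CompactSpace Y]
    [Surjective f] (hf : f.appTop.hom.IsIntegral) (p : PrimeSpectrum Γ(Y, ⊤)) :
    p ∈ Set.range (PrimeSpectrum.comap f.appTop.hom) := by
  let := f.appTop.hom.toAlgebra
  have : Algebra.IsIntegral Γ(Y, ⊤) Γ(X, ⊤) := ⟨hf⟩
  obtain ⟨Q, -, hQ, hQp⟩ := Ideal.exists_ideal_over_prime_of_isIntegral p.asIdeal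
    (⊥ : Ideal Γ(X, ⊤))
    (fun a ha ↦ nilradical_le_prime p.asIdeal (mem_nilradical_of_mem_ker f ha))
  exact ⟨⟨Q, hQ⟩, PrimeSpectrum.ext hQp⟩

theorem isAffine_of_isIntegral {X Y : Scheme.{u}} [IsIntegral X] [IsIntegral Y] [IsAffine X]
    [AlgebraicGeometry.IsNoetherian Y] (f : X ⟶ Y) [IsFinite f] [Surjective f]
    (H : ∀ {Z : Scheme.{u}} (i : Z ⟶ Y) [IsClosedImmersion i], IsIso i ∨ IsAffine Z) :
    IsAffine Y := by
  obtain ⟨ι, _, V, hV, hne⟩ := exists_finite_affine_cover Y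
  have hη : ∀ i, genericPoint Y ∈ (V i).1 := fun i ↦ genericPoint_mem (hne i).some_mem
  let := (functionFieldMap f).toAlgebra
  have hcomm : ∀ i, ∀ r : Γ(Y, (V i).1), algebraMap Y.functionField X.functionField
      (germη (hη i) r) = germη (genericPoint_mem_preimage f (hη i)) (pull f (V i).1 r) :=
    fun i r ↦ functionFieldMap_germη f (hη i) r
  have hfin : ∀ i, (pull f (V i).1).Finite := fun i ↦ f.finite_app (V i).1 (V i).2
  have : FiniteDimensional Y.functionField X.functionField := by
    have hmem : genericPoint Y ∈ ⨆ i, (V i).1 := by rw [hV]; trivial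
    obtain ⟨i, -⟩ := Opens.mem_iSup.mp hmem
    exact finiteDimensional_of_finite (hcomm i) (hfin i)
      (exists_eq_germη_div ((V i).2.preimage f) _)
  let e := Module.finBasis Y.functionField X.functionField
  choose t ht ht' using fun i ↦ exists_denominator e (hcomm i) (hfin i) (germη_injective (hη i))
    (exists_eq_germη_div (V i).2 (hη i))
  obtain ⟨D, hηD, hD⟩ := exists_idealSheafData_le_span V hη t ht
  have hD' : ∀ i, ∀ d ∈ D.ideal (V i), ∀ (s : Γ(X, f ⁻¹ᵁ (V i).1)) (j k),
      germη (hη i) d * Algebra.leftMulMatrix e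
        (germη (genericPoint_mem_preimage f (hη i)) s) j k ∈ (germη (hη i)).range := by
    intro i d hd s j k
    obtain ⟨x, rfl⟩ := Ideal.mem_span_singleton'.mp (hD i hd)
    rw [map_mul, mul_assoc]
    exact mul_mem ⟨x, rfl⟩ (ht' i s j k)
  let i := (D * D).subschemeι
  have hi : ¬ IsIso i := by
    intro h
    obtain ⟨z, hz⟩ := i.surjective (genericPoint Y)
    have : genericPoint Y ∈ Set.range (D * D).subschemeι := ⟨z, hz⟩
    rw [Scheme.IdealSheafData.range_subschemeι, Scheme.IdealSheafData.support_mul] at this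
    exact hηD (by simpa using this)
  have := (H i).resolve_left hi
  have key := exists_monic_of_agree f rfl e V hV hη D hD'
  have : Y.IsQuasiAffine := by
    refine isQuasiAffine_of_forall_exists f i (fun y ↦ Or.inl (f.surjective y)) fun b c hbc ↦ ?_
    obtain ⟨p, -, hpb, hp⟩ := key b c hbc
    refine ⟨p.coeff 0, fun y ↦ ⟨fun hy ↦ ?_, fun hy ↦ hp y hy.1⟩⟩
    have hb : ∀ x : X, f x = y → x ∈ X.basicOpen b := by
      rintro x rfl
      exact mem_basicOpen_of_eval₂_eq_zero f p b hpb x hy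
    refine ⟨hb, fun z hz ↦ ?_⟩
    obtain ⟨x, hx⟩ := f.surjective y
    obtain ⟨w, hw, hw'⟩ := Scheme.Pullback.exists_preimage_pullback x z (hx.trans hz.symm)
    have h1 : w ∈ pullback.fst f i ⁻¹ᵁ X.basicOpen b := by
      change _ ∈ X.basicOpen b
      rw [hw]
      exact hb x hx
    rw [Scheme.preimage_basicOpen_top, hbc, ← Scheme.preimage_basicOpen_top] at h1
    rw [← hw']
    exact h1
  have hintegral : f.appTop.hom.IsIntegral := by
    refine isIntegral_of_forall_agree _ (pullback.fst f i).appTop.hom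
      (pullback.snd f i).appTop.hom (appTop_surjective_of_isClosedImmersion _)
      (pullback.snd f i).finite_appTop.to_isIntegral fun b c hbc ↦ ?_
    obtain ⟨p, hpm, hpb, -⟩ := key b c hbc
    exact ⟨p, hpm, hpb⟩
  exact isAffine_of_isQuasiAffine_of_range_union f f
    fun p ↦ Or.inl (mem_range_comap_of_isIntegral f hintegral p)

/-! ### Nilpotents, dévissage and noetherian induction -/

theorem eq_zero_of_forall_affineOpens {Y : Scheme.{u}} {U : Y.Opens} (s : Γ(Y, U))
    (h : ∀ (W : Y.affineOpens) (hW : W.1 ≤ U), res hW s = 0) : s = 0 := by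
  choose W hW hy hWU using fun y : U ↦ exists_isAffineOpen_mem_and_subset (X := Y) y.2
  refine Y.sheaf.eq_of_locally_eq' W U (fun y ↦ homOfLE (hWU y))
    (fun y hyU ↦ Opens.mem_iSup.mpr ⟨⟨y, hyU⟩, hy ⟨y, hyU⟩⟩) s 0 fun y ↦ ?_
  exact (h ⟨W y, hW y⟩ (hWU y)).trans (map_zero (res (hWU y))).symm

theorem isReduced_of_nilradical_eq_bot {Y : Scheme.{u}} (h : Y.nilradical = ⊥) : IsReduced Y := by
  refine ⟨fun U ↦ ⟨fun s hs ↦ eq_zero_of_forall_affineOpens s fun W hW ↦ ?_⟩⟩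
  have : res hW s ∈ Y.nilradical.ideal W := mem_nilradical.mpr (hs.map (res hW))
  rwa [h] at this

theorem isAffine_of_mul_self_eq_bot {Y : Scheme.{u}} (I : Y.IdealSheafData) (hI : I * I = ⊥)
    [IsAffine I.subscheme] : IsAffine Y := by
  have hsupp : I.support = ⊤ := by
    rw [← Scheme.IdealSheafData.support_bot, ← hI, Scheme.IdealSheafData.support_mul, sup_idem]
  have : Surjective I.subschemeι := by
    refine ⟨Set.range_eq_univ.mp ?_⟩
    rw [Scheme.IdealSheafData.range_subschemeι, hsupp]
    rfl
  refine isAffine_of_sq_zero I.subschemeι fun U s t hs ht ↦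
    eq_zero_of_forall_affineOpens _ fun W hW ↦ ?_
  have hmem : ∀ s : Γ(Y, U), pull I.subschemeι U s = 0 → res hW s ∈ I.ideal W := by
    intro s hs
    rw [← I.ker_subschemeι_app W]
    change pull I.subschemeι W.1 (res hW s) = 0
    rw [pull_res _ hW fun _ hx ↦ hW hx, hs, map_zero]
  have h : res hW s * res hW t ∈ (I * I).ideal W := Ideal.mul_mem_mul (hmem s hs) (hmem t ht)
  rw [hI] at h
  rw [map_mul]
  exact h

theorem isNilpotent_nilradical (Y : Scheme.{u}) [AlgebraicGeometry.IsNoetherian Y] :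
    IsNilpotent Y.nilradical := by
  obtain ⟨ι, _, V, hV, -⟩ := exists_finite_affine_cover Y
  have : ∀ i, ∃ n, Y.nilradical.ideal (V i) ^ n = ⊥ := fun i ↦
    have : IsNoetherianRing Γ(Y, (V i).1) := IsLocallyNoetherian.component_noetherian (V i)
    IsNoetherianRing.isNilpotent_nilradical Γ(Y, (V i).1)
  choose n hn using this
  obtain ⟨N, hN⟩ := Finite.bddAbove_range n
  refine ⟨N, Scheme.IdealSheafData.ext_of_iSup_eq_top V hV fun i ↦ ?_⟩
  exact le_bot_iff.mp ((Ideal.pow_le_pow_right (hN ⟨i, rfl⟩)).trans (hn i).le)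

/-- A finite surjective morphism from an affine scheme to an irreducible scheme restricts to one
from an integral closed subscheme. -/
theorem exists_isIntegral_of_surjective {X Y : Scheme.{u}} [IrreducibleSpace Y] [IsAffine X]
    (f : X ⟶ Y) [IsFinite f] [Surjective f] :
    ∃ (W : Scheme.{u}) (g : W ⟶ Y), IsIntegral W ∧ IsAffine W ∧ IsFinite g ∧ Surjective g := by
  obtain ⟨x, hx⟩ := f.surjective (genericPoint Y)
  let p : PrimeSpectrum Γ(X, ⊤) := X.isoSpec.hom x
  -- The integral source is the closure of a point over the generic point; its image is closed and
  -- contains that point.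
  let j := Spec.map (CommRingCat.ofHom (Ideal.Quotient.mk p.asIdeal))
  have : IsClosedImmersion j := IsClosedImmersion.spec_of_surjective _ Ideal.Quotient.mk_surjective
  let g := j ≫ X.isoSpec.inv ≫ f
  refine ⟨_, g, inferInstance, inferInstance, inferInstance, ⟨Set.range_eq_univ.mp ?_⟩⟩
  have hη : genericPoint Y ∈ Set.range g := by
    refine ⟨(⊥ : PrimeSpectrum (Γ(X, ⊤) ⧸ p.asIdeal)), ?_⟩
    have h1 : j (⊥ : PrimeSpectrum (Γ(X, ⊤) ⧸ p.asIdeal)) = X.isoSpec.hom x :=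
      PrimeSpectrum.ext (Ideal.mk_ker (I := p.asIdeal))
    rw [← hx]
    change f (X.isoSpec.inv (j _)) = _
    rw [h1]
    simp
  rw [← Set.univ_subset_iff, ← show closure {genericPoint Y} = Set.univ from genericPoint_spec Y]
  exact closure_minimal (Set.singleton_subset_iff.mpr hη) g.isClosedMap.isClosed_range

theorem isAffine_of_forall_closed {X Y : Scheme.{u}} [IsAffine X]
    [AlgebraicGeometry.IsNoetherian Y] (f : X ⟶ Y) [IsFinite f] [Surjective f]
    (H : ∀ {Z : Scheme.{u}} (i : Z ⟶ Y) [IsClosedImmersion i], IsIso i ∨ IsAffine Z) :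
    IsAffine Y := by
  by_cases hnil : Y.nilradical = ⊥
  · have := isReduced_of_nilradical_eq_bot hnil
    cases isEmpty_or_nonempty Y
    · infer_instance
    by_cases hirr : IsPreirreducible (Set.univ : Set Y)
    · have : IrreducibleSpace Y := { toPreirreducibleSpace := ⟨hirr⟩, toNonempty := ‹_› }
      have : IsIntegral Y := isIntegral_of_irreducibleSpace_of_isReduced _
      obtain ⟨W, g, _, _, _, _⟩ := exists_isIntegral_of_surjective f
      exact isAffine_of_isIntegral g H
    · rw [isPreirreducible_iff_isClosed_union_isClosed] at hirr
      push Not at hirr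
      obtain ⟨T₁, T₂, hT₁, hT₂, hT, h₁, h₂⟩ := hirr
      let I (T : Closeds Y) := Scheme.IdealSheafData.vanishingIdeal T
      have hr : ∀ T : Closeds Y, Set.range (I T).subschemeι = T := by
        intro T
        rw [Scheme.IdealSheafData.range_subschemeι]
        rfl
      have haff : ∀ T : Closeds Y, ¬ Set.univ ⊆ (T : Set Y) → IsAffine (I T).subscheme := by
        intro T hT
        refine (H (I T).subschemeι).resolve_left fun h ↦ hT ?_
        rw [← hr T, (I T).subschemeι.surjective.range_eq]
      have := haff ⟨T₁, hT₁⟩ h₁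
      have := haff ⟨T₂, hT₂⟩ h₂
      refine isAffine_of_closed_cover (I ⟨T₁, hT₁⟩).subschemeι (I ⟨T₂, hT₂⟩).subschemeι fun y ↦ ?_
      rw [hr, hr]
      exact hT (Set.mem_univ y)
  · classical
    have hex := isNilpotent_nilradical Y
    let n := Nat.find hex
    have hn : Y.nilradical ^ n = ⊥ := Nat.find_spec hex
    -- This gives `2 * (n - 1) ≥ n`, so the last nonzero power of the nilradical squares to zero.
    have hn2 : 2 ≤ n := by
      by_contra! hlt
      refine hnil (le_bot_iff.mp ?_)
      rw [← hn]
      interval_cases n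
      · rw [pow_zero]
        exact le_top
      · rw [pow_one]
    have hmin : Y.nilradical ^ (n - 1) ≠ ⊥ := Nat.find_min hex (by omega : n - 1 < n)
    have hsq : Y.nilradical ^ (n - 1) * Y.nilradical ^ (n - 1) = ⊥ := by
      rw [← pow_add, show n - 1 + (n - 1) = n + (n - 2) by omega, pow_add, hn]
      exact Scheme.IdealSheafData.bot_mul _
    have := (H (Y.nilradical ^ (n - 1)).subschemeι).resolve_left fun h ↦
      hmin ((Scheme.isIso_subschemeι_iff_eq_bot _).mp h)
    exact isAffine_of_mul_self_eq_bot _ hsq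

/-- An ideal sheaf is determined by its ideals on finitely many charts, each with a noetherian ring.
-/
theorem wellFoundedGT_idealSheafData (Y : Scheme.{u}) [AlgebraicGeometry.IsNoetherian Y] :
    WellFoundedGT Y.IdealSheafData := by
  obtain ⟨ι, _, V, hV, -⟩ := exists_finite_affine_cover Y
  have (i : ι) : IsNoetherianRing Γ(Y, (V i).1) := IsLocallyNoetherian.component_noetherian (V i)
  let F : Y.IdealSheafData → ∀ i, Ideal Γ(Y, (V i).1) := fun I i ↦ I.ideal (V i)
  have hF : StrictMono F := by
    refine Monotone.strictMono_of_injective (fun I J h i ↦ h (V i)) fun I J h ↦ ?_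
    exact Scheme.IdealSheafData.ext_of_iSup_eq_top V hV fun i ↦ congrFun h i
  suffices WellFoundedGT (∀ i, Ideal Γ(Y, (V i).1)) from hF.wellFoundedGT
  rw [wellFoundedGT_iff_monotone_chain_condition]
  intro a
  choose n hn using fun i ↦ WellFoundedGT.monotone_chain_condition
    ((⟨Function.eval i, Function.monotone_eval i⟩ : _ →o Ideal Γ(Y, (V i).1)).comp a)
  obtain ⟨N, hN⟩ := Finite.bddAbove_range n
  refine ⟨N, fun m hm ↦ funext fun i ↦ ?_⟩
  have hi : n i ≤ N := hN ⟨i, rfl⟩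
  exact (hn i N hi).symm.trans (hn i m (hi.trans hm))

/-- All closed subschemes are treated at once because the hypotheses on `f` survive base change to
each, and proper closed subschemes have strictly larger ideals. -/
theorem isAffine_subscheme {X Y : Scheme.{u}} (f : X ⟶ Y) [IsAffine X]
    [AlgebraicGeometry.IsNoetherian Y] [IsFinite f] [Surjective f] (I : Y.IdealSheafData) :
    IsAffine I.subscheme := by
  have := wellFoundedGT_idealSheafData Y
  induction I using WellFoundedGT.induction with
  | ind I IH =>
    have : IsLocallyNoetherian I.subscheme :=
      LocallyOfFiniteType.isLocallyNoetherian I.subschemeι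
    have : CompactSpace I.subscheme := QuasiCompact.compactSpace_of_compactSpace I.subschemeι
    have : AlgebraicGeometry.IsNoetherian I.subscheme := {}
    have : IsAffine (pullback f I.subschemeι) := isAffine_of_isAffineHom (pullback.fst _ _)
    refine isAffine_of_forall_closed (pullback.snd f I.subschemeι) fun {Z} i _ ↦ ?_
    refine or_iff_not_imp_left.mpr fun hi ↦ ?_
    let k := i ≫ I.subschemeι
    have hle : I ≤ k.ker := by
      have := Scheme.Hom.le_ker_comp i I.subschemeι
      rwa [Scheme.IdealSheafData.ker_subschemeι] at this
    have hne : I ≠ k.ker := fun h ↦ hi <|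
      IsClosedImmersion.isIso_of_ker_eq k I.subschemeι i rfl (by
        rw [Scheme.IdealSheafData.ker_subschemeι, ← h])
    have := IH k.ker (lt_of_le_of_ne hle hne)
    exact .of_isIso k.toImage

end AlgebraicGeometry.Chevalley

theorem mainTheorem5 {X Y : Scheme.{u}} (f : X ⟶ Y)
    [IsAffine X] [AlgebraicGeometry.IsNoetherian Y] [IsFinite f]
    [AlgebraicGeometry.Surjective f] : IsAffine Y := by
  have := Chevalley.isAffine_subscheme f ⊥
  exact .of_isIso (inv (Scheme.IdealSheafData.subschemeι (⊥ : Y.IdealSheafData)))
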